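/- Let $r\ge 2$. Let $\Sigma$ be a compact nodal orbicurve with marked points: the connected curve $\Sigma$ is the image of finitely many compact Riemann surfaces $\Sigma_\nu$ under continuous, locally homeomorphic-onto-image maps, every point has at most two preimages, there are finitely many points with two preimages (the nodes), and the marked points are distinct points with exactly one preimage. Near a marked point the curve is uniformized by $z\mapsto z^m$ with local group $\mathbb Z/m$, near a node by $(x,y)\mapsto(x^m,y^m)$ on $\{xy=0\}$ with the action $(x,y)\mapsto(\zeta x,\zeta^{-1}y)$, $\zeta=e^{2\pi i/m}$, $m\ge1$. Let $L$ be a holomorphic orbifold line bundle on $\Sigma$ with an isomorphism $\phi:L^{\otimes r}\to K_{\log}$, where $K_{\log}$ is the (pulled back) log-canonical bundle of the nodal curve: it is generated by $dz/z$ at marked points and on the branches of nodes, with $dx/x=-dy/y$ in the fibre over a node. The generator $\zeta$ of the local group acts on a local trivialization of $L$ by $w\mapsto\zeta^{d}w$, $0\le d<m$ (at a node: $(x,y,w)\mapsto(\zeta x,\zeta^{-1}y,\zeta^{d}w)$). A marked or nodal point is called Ramond if $d=0$ and Neveu–Schwarz if $d>0$. Suppose that all marked points are Neveu–Schwarz;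 the nodes may be of either type. Let $|L|$ be the desingularization of $L$ on the components: in the coordinate $u=z^m$ at a special point of a component, where $\zeta$ acts by $(z,w)\mapsto(\zeta z,\zeta^{d}w)$, a section of $|L|$ with local representative $g(u)$ is the section $z^{d}g(z^m)$ of $L$. Let $s$ be a section of $|L|$ that is smooth away from the Ramond nodes (in particular as a section of $|L|$ at the marked points and on both branches of every Neveu–Schwarz node), is continuous on both branches of every Ramond node, and has equal values on these two branches at the node; no gluing condition is imposed at Neveu–Schwarz nodes. Fix a smooth Hermitian metric $h$ on $L$ over the complement of the marked and nodal points (for example the restriction of a smooth Hermitian metric on $L$ or on $|L|$). Let $\bar s^{\,r-1}$ be the $L$-valued $(0,1)$-form obtained from the complex conjugate of $s^{r-1}\in K_{\log}\otimes L^{-1}$ by the isomorphism $\bar L^{-1}\cong L$ given by $h$: if $s=f e$ and $\phi(e^r)=A\,dz$ for a local holomorphic frame $e$, then $\bar s^{\,r-1}=h(e,e)^{-1}\,\overline{A f^{\,r-1}}\,d\bar z\otimes e$. Then $$\bar\partial s+\bar s^{\,r-1}=0\ \text{ away from the marked and nodal points}\quad\Longleftrightarrow\quad s=0 .$$ -/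

import Mathlib

open scoped Manifold ContDiff Topology ComplexConjugate

noncomputable section

/-- A nodal curve with marked points. `N` is the disjoint union of the components (a compact,
possibly disconnected, one-dimensional complex manifold), `C` is the nodal curve itself, and `π`
is the map that is given on each component by the map of that component to `C`. -/
structure NodalCurve (N C : Type*) [TopologicalSpace N] [ChartedSpace ℂ N]
    [IsManifold 𝓘(ℂ) ω N] [CompactSpace N] [T2Space N]
    [TopologicalSpace C] [ConnectedSpace C] where
  π : N → C
  continuous_π : Continuous π
  surjective_π : Function.Surjective π
  /-- every point has a neighbourhood that `π` maps homeomorphically onto its image -/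
  locallyEmbedding_π : ∀ x : N, ∃ U ∈ 𝓝 x, Topology.IsEmbedding (U.domRestrict π)
  fiber_le_two : ∀ z : C, (π ⁻¹' {z}).encard ≤ 2
  finite_nodes : {z : C | (π ⁻¹' {z}).encard = 2}.Finite
  /-- the number of marked points -/
  k : ℕ
  mark : Fin k → C
  mark_injective : Function.Injective mark
  fiber_mark : ∀ i, (π ⁻¹' {mark i}).encard = 1

namespace NodalCurve

variable {N C : Type*} [TopologicalSpace N] [ChartedSpace ℂ N]
    [IsManifold 𝓘(ℂ) ω N] [CompactSpace N] [T2Space N]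
    [TopologicalSpace C] [ConnectedSpace C] (S : NodalCurve N C)

/-- `z` is a nodal point. -/
def IsNode (z : C) : Prop := (S.π ⁻¹' {z}).encard = 2

/-- `z` is a marked point. -/
def IsMarked (z : C) : Prop := z ∈ Set.range S.mark

/-- A point of a component is special if it lies over a nodal or a marked point. -/
def IsSpecial (p : N) : Prop := S.IsNode (S.π p) ∨ S.IsMarked (S.π p)

end NodalCurve

/-- A nodal orbicurve: a nodal curve with a local orbifold group `ℤ/m`, `m = ord z`, at each
point `z`, trivial away from nodal and marked points. A branch of the curve through `z` is
uniformized by `x ↦ x ^ m`; at a node both branches carry the same order. The group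
action on the uniformizing charts is part of the structure of an orbifold line bundle below. -/
structure NodalOrbicurve (N C : Type*) [TopologicalSpace N] [ChartedSpace ℂ N]
    [IsManifold 𝓘(ℂ) ω N] [CompactSpace N] [T2Space N]
    [TopologicalSpace C] [ConnectedSpace C] extends NodalCurve N C where
  ord : C → ℕ
  one_le_ord : ∀ z, 1 ≤ ord z
  ord_eq_one : ∀ z, ¬ toNodalCurve.IsNode z → ¬ toNodalCurve.IsMarked z → ord z = 1

/-- An atlas of uniformizing charts for a nodal orbicurve. The chart at `p` is a holomorphic
coordinate `u` centred at `p`, together with the branched covering `z ↦ u⁻¹ (z ^ m)`,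
where `m` is the order of the local group at `p`. A special point lies in its own chart only. -/
structure OrbifoldAtlas {N C : Type*} [TopologicalSpace N] [ChartedSpace ℂ N]
    [IsManifold 𝓘(ℂ) ω N] [CompactSpace N] [T2Space N]
    [TopologicalSpace C] [ConnectedSpace C] (S : NodalOrbicurve N C) where
  chart : N → OpenPartialHomeomorph N ℂ
  chart_mem : ∀ p, chart p ∈ IsManifold.maximalAtlas 𝓘(ℂ) ω N
  mem_source : ∀ p, p ∈ (chart p).source
  chart_self : ∀ p, chart p p = 0
  special_eq : ∀ p q, q ∈ (chart p).source → S.IsSpecial q → q = p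

namespace OrbifoldAtlas

variable {N C : Type*} [TopologicalSpace N] [ChartedSpace ℂ N]
    [IsManifold 𝓘(ℂ) ω N] [CompactSpace N] [T2Space N]
    [TopologicalSpace C] [ConnectedSpace C] {S : NodalOrbicurve N C} (A : OrbifoldAtlas S)

/-- The domain of the uniformizing chart at `p`. -/
def dom (p : N) : Set ℂ := {z | z ^ S.ord (S.π p) ∈ (A.chart p).target}

/-- The branched covering from the uniformizing chart at `p` to the component of `p`. -/
def proj (p : N) (z : ℂ) : N := (A.chart p).symm (z ^ S.ord (S.π p))

/-- The points of the uniformizing chart at `p` that do not lie over a special point. -/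
def regDom (p : N) : Set ℂ := {z ∈ A.dom p | ¬ S.IsSpecial (A.proj p z)}

/-- `z` in the chart at `p` and `w` in the chart at `q` lie over the same non-special point. -/
def Overlap (p q : N) (z w : ℂ) : Prop :=
  z ∈ A.regDom p ∧ w ∈ A.regDom q ∧ A.proj p z = A.proj q w

/-- `σ` is, near `z₀`, a holomorphic change of coordinates from the uniformizing chart at `p` to
the one at `q`. For `p = q` these are the rotations in the local group. -/
def IsTransition (p q : N) (σ : ℂ → ℂ) (z₀ : ℂ) : Prop :=
  AnalyticAt ℂ σ z₀ ∧ ∀ᶠ z in 𝓝 z₀, A.Overlap p q z (σ z)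

end OrbifoldAtlas

/-- A holomorphic orbifold line bundle on a nodal orbicurve, given by its trivializations
`(uniformizing chart at p) × ℂ` and its transition functions: for `z`, `z'` over the same
non-special point, `(z, w)` in the chart at `p` is identified with `(z', T p q z z' * w)` in the
chart at `q`. The generator `ζ = exp (2πi/m)` of the local group acts on the chart at `p` by
`(z, w) ↦ (ζ z, ζ ^ d w)` with `0 ≤ d < m`. At a node the two charts at the two preimages `p ≠ q`
are the two branches of one trivialization over `{xy = 0}`, on which the generator acts
by `(x, y, w) ↦ (ζ x, ζ⁻¹ y, ζ ^ d w)`; so `d p + d q` is divisible by `m`, and the vectors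
`(0, w)` over `p` and `(0, w)` over `q` are the same vector of the fibre over the node. -/
structure OrbifoldLineBundle {N C : Type*} [TopologicalSpace N] [ChartedSpace ℂ N]
    [IsManifold 𝓘(ℂ) ω N] [CompactSpace N] [T2Space N]
    [TopologicalSpace C] [ConnectedSpace C] (S : NodalOrbicurve N C) where
  atlas : OrbifoldAtlas S
  d : N → ℕ
  d_lt : ∀ p, d p < S.ord (S.π p)
  balanced : ∀ p q, p ≠ q → S.π p = S.π q → S.ord (S.π p) ∣ d p + d q
  T : N → N → ℂ → ℂ → ℂ
  T_rotation : ∀ p, ∀ z ∈ atlas.regDom p, ∀ ζ : ℂ, ζ ^ S.ord (S.π p) = 1 →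
    T p p z (ζ * z) = ζ ^ d p
  T_cocycle : ∀ p₁ p₂ p₃ z₁ z₂ z₃, atlas.Overlap p₁ p₂ z₁ z₂ → atlas.Overlap p₂ p₃ z₂ z₃ →
    T p₁ p₃ z₁ z₃ = T p₂ p₃ z₂ z₃ * T p₁ p₂ z₁ z₂
  T_holomorphic : ∀ p q σ z₀, atlas.IsTransition p q σ z₀ →
    AnalyticAt ℂ (fun z => T p q z (σ z)) z₀

namespace OrbifoldLineBundle

variable {N C : Type*} [TopologicalSpace N] [ChartedSpace ℂ N]
    [IsManifold 𝓘(ℂ) ω N] [CompactSpace N] [T2Space N]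
    [TopologicalSpace C] [ConnectedSpace C] {S : NodalOrbicurve N C} (L : OrbifoldLineBundle S)

/-- A special point is Neveu-Schwarz if the local group acts on the fibre with `d > 0`. -/
def IsNeveuSchwarz (p : N) : Prop := S.IsSpecial p ∧ 0 < L.d p

/-- `p` is a preimage of a Ramond nodal point. -/
def IsRamondNode (p : N) : Prop := S.IsNode (S.π p) ∧ L.d p = 0

end OrbifoldLineBundle

open Classical in
/-- The standard local frame of the log-canonical bundle, pulled back to the uniformizing chart
at `p`, is `klogCoeff S p z • dz`: it is `dz / z` at a nodal or marked point and `dz` elsewhere. -/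
def klogCoeff {N C : Type*} [TopologicalSpace N] [ChartedSpace ℂ N]
    [IsManifold 𝓘(ℂ) ω N] [CompactSpace N] [T2Space N]
    [TopologicalSpace C] [ConnectedSpace C] (S : NodalOrbicurve N C) (p : N) (z : ℂ) : ℂ :=
  if S.IsSpecial p then z⁻¹ else 1

/-- An isomorphism `φ` of the `r`-th tensor power of `L` with the log-canonical bundle of the nodal
curve. In the chart at `p`, the `r`-th power of the frame `e p` goes to `a p z` times the standard
frame of the log-canonical bundle. At a node the log-canonical bundle of the nodal curve is the
dualizing sheaf, for which `dx/x` and `-dy/y` are the same vector of the fibre over the node. -/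
structure LogCanonicalRoot {N C : Type*} [TopologicalSpace N] [ChartedSpace ℂ N]
    [IsManifold 𝓘(ℂ) ω N] [CompactSpace N] [T2Space N]
    [TopologicalSpace C] [ConnectedSpace C] {S : NodalOrbicurve N C}
    (L : OrbifoldLineBundle S) (r : ℕ) where
  a : N → ℂ → ℂ
  holomorphic : ∀ p, AnalyticOnNhd ℂ (a p) (L.atlas.dom p)
  ne_zero : ∀ p, ∀ z ∈ L.atlas.dom p, a p z ≠ 0
  compatible : ∀ p q σ z₀, L.atlas.IsTransition p q σ z₀ →
    a p z₀ * klogCoeff S p z₀ =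
      a q (σ z₀) * klogCoeff S q (σ z₀) * deriv σ z₀ * L.T p q z₀ (σ z₀) ^ r
  node : ∀ p q, p ≠ q → S.π p = S.π q → a p 0 = - a q 0

/-- A smooth Hermitian metric on `L` over the complement of the special points; `h p z` is the
square of the norm of the vector `(z, 1)` in the chart at `p`. Every Hermitian metric on `L`, or on
its desingularization, restricts to one of these. -/
structure HermitianMetric {N C : Type*} [TopologicalSpace N] [ChartedSpace ℂ N]
    [IsManifold 𝓘(ℂ) ω N] [CompactSpace N] [T2Space N]
    [TopologicalSpace C] [ConnectedSpace C] {S : NodalOrbicurve N C}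
    (L : OrbifoldLineBundle S) where
  h : N → ℂ → ℝ
  pos : ∀ p, ∀ z ∈ L.atlas.regDom p, 0 < h p z
  smooth : ∀ p, ContDiffOn ℝ ∞ (h p) (L.atlas.regDom p)
  compatible : ∀ p q z w, L.atlas.Overlap p q z w → h p z = ‖L.T p q z w‖ ^ 2 * h q w

/-- A section of the desingularization `|L|`: in the coordinate `u = z ^ m` at `p` and the frame of
`|L|` that is `z ^ d` times the frame of `L`, it is the function `g p u`; so it is
`z ^ d * g p (z ^ m)` as a section of `L`. It is smooth on every component, also at Neveu-Schwarz
points; at the two preimages of a Ramond node it has to be continuous and its two values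
there have to agree, while there is no gluing condition at a Neveu-Schwarz node. -/
structure DesingSection {N C : Type*} [TopologicalSpace N] [ChartedSpace ℂ N]
    [IsManifold 𝓘(ℂ) ω N] [CompactSpace N] [T2Space N]
    [TopologicalSpace C] [ConnectedSpace C] {S : NodalOrbicurve N C}
    (L : OrbifoldLineBundle S) where
  g : N → ℂ → ℂ
  smooth : ∀ p, ¬ L.IsRamondNode p → ContDiffOn ℝ ∞ (g p) (L.atlas.chart p).target
  smooth_ramond : ∀ p, L.IsRamondNode p →
    ContDiffOn ℝ ∞ (g p) ((L.atlas.chart p).target \ {0})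
  continuous_ramond : ∀ p, L.IsRamondNode p → ContinuousOn (g p) (L.atlas.chart p).target
  compatible : ∀ p q z w, L.atlas.Overlap p q z w →
    w ^ L.d q * g q (w ^ S.ord (S.π q)) = L.T p q z w * (z ^ L.d p * g p (z ^ S.ord (S.π p)))
  node : ∀ p q, p ≠ q → S.π p = S.π q → L.IsRamondNode p → g p 0 = g q 0

/-- The Wirtinger derivative `∂f/∂z̄`. -/
def wirtingerBar (f : ℂ → ℂ) (z : ℂ) : ℂ :=
  (1 / 2) * (fderiv ℝ f z 1 + Complex.I * fderiv ℝ f z Complex.I)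

namespace DesingSection

variable {N C : Type*} [TopologicalSpace N] [ChartedSpace ℂ N]
    [IsManifold 𝓘(ℂ) ω N] [CompactSpace N] [T2Space N]
    [TopologicalSpace C] [ConnectedSpace C] {S : NodalOrbicurve N C}
    {L : OrbifoldLineBundle S} (s : DesingSection L)

/-- The coefficient of the section in the chart at `p`, as a section of `L`. -/
def rep (p : N) (z : ℂ) : ℂ := z ^ L.d p * s.g p (z ^ S.ord (S.π p))

/-- The coefficient of `∂̄s`, a `(0,1)`-form with values in `L`, in the frame `dz̄ ⊗ e p`. -/
def dbarCoeff (p : N) (z : ℂ) : ℂ := wirtingerBar (s.rep p) z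

/-- The coefficient of `s̄ ^ (r-1)` in the frame `dz̄ ⊗ e p`. By `φ`, `s ^ (r-1)` is the section
`a (dz/z or dz) f ^ (r-1) ⊗ e⁻¹` of the log-canonical bundle tensor the dual of `L`; the metric
identifies the conjugate `ē⁻¹` with `h⁻¹ e`. -/
def conjPowCoeff {r : ℕ} (φ : LogCanonicalRoot L r) (H : HermitianMetric L) (p : N) (z : ℂ) : ℂ :=
  conj (φ.a p z * klogCoeff S p z * s.rep p z ^ (r - 1)) / (H.h p z : ℂ)

/-- The spin equation `∂̄s + s̄ ^ (r-1) = 0`. -/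
def SpinEquation {r : ℕ} (φ : LogCanonicalRoot L r) (H : HermitianMetric L) : Prop :=
  ∀ p, ∀ z ∈ L.atlas.regDom p, s.dbarCoeff p z + s.conjPowCoeff φ H p z = 0

/-- The section is zero. -/
def IsZero : Prop := ∀ p, ∀ u ∈ (L.atlas.chart p).target, s.g p u = 0

end DesingSection

end

noncomputable section

open MeasureTheory Set Filter

/-! ### The Wirtinger derivative -/

/-! Apply Stokes' theorem to the `(1,0)`-form `η = φ(s ^ r)` on the compact, possibly disconnected,
normalization `N`. Away from the special points `η = a f ^ r dz`, with `a` holomorphic. The spin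
equation replaces `∂̄f` by `-conj (a f ^ (r-1)) / h`, so the `dz̄`-coefficient of `∂̄η` is `-r |a f
^ (r-1)|² / h ≤ 0` (`chartDbar_logForm`). If the total integral of `∂̄η` is zero, then `s ^ (r-1)`
vanishes at every regular point. Since `r - 1 ≠ 0`, so does `s`, and continuity covers the special
points.

The total integral is governed by residues. In the uniformizing chart at a special point `η` is `a f
^ r dz/z`, and `du/u = m dz/z` for `u = z ^ m`, so `η` has at most a simple pole with residue `a(0)
f(0) ^ r / m` (`tendsto_residue`). At a Neveu-Schwarz point `f = z ^ d g` vanishes at the origin,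
hence so does the residue. At a Ramond node the two values of `s` agree while `dx/x = -dy/y`, so the
residues of the two branches cancel (`residue_add_residue`). Thus the residues over all components
add up to zero, although they need not on a single component.

The analytic core is `PolarForm.chartDbar_eq_zero`. Because `∂̄η` is not known to be integrable near
the poles, `η` is multiplied by a function that vanishes on small discs around them. Stokes' theorem
leaves integrals over annuli, which tend to a universal constant times the sum of the residues
(`tendsto_integral_chartHole_mul`), that is, to zero. The sign of `∂̄η` bounds these integrals below
by a fixed positive number as soon as `∂̄η` is nonzero at one point. -/

theorem wirtingerBar_congr {f g : ℂ → ℂ} {z : ℂ} (h : f =ᶠ[𝓝 z] g) :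
    wirtingerBar f z = wirtingerBar g z := by
  simp only [wirtingerBar, h.fderiv_eq]

theorem wirtingerBar_const (c z : ℂ) : wirtingerBar (fun _ => c) z = 0 := by
  simp [wirtingerBar]

theorem wirtingerBar_mul {f g : ℂ → ℂ} {z : ℂ} (hf : DifferentiableAt ℝ f z)
    (hg : DifferentiableAt ℝ g z) :
    wirtingerBar (fun w => f w * g w) z = wirtingerBar f z * g z + f z * wirtingerBar g z := by
  simp only [wirtingerBar, fderiv_fun_mul hf hg, _root_.add_apply,
    _root_.smul_apply, smul_eq_mul]
  ring

theorem wirtingerBar_pow {f : ℂ → ℂ} {z : ℂ} (hf : DifferentiableAt ℝ f z) (n : ℕ) :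
    wirtingerBar (fun w => f w ^ n) z = n * f z ^ (n - 1) * wirtingerBar f z := by
  have h := (hf.hasFDerivAt.pow n).fderiv
  simp only [wirtingerBar]
  rw [h]
  simp only [_root_.smul_apply, smul_eq_mul, nsmul_eq_mul]
  ring

theorem wirtingerBar_sum {ι : Type*} (t : Finset ι) {f : ι → ℂ → ℂ} {z : ℂ}
    (hf : ∀ i ∈ t, DifferentiableAt ℝ (f i) z) :
    wirtingerBar (fun w => ∑ i ∈ t, f i w) z = ∑ i ∈ t, wirtingerBar (f i) z := by
  simp only [wirtingerBar]
  rw [fderiv_fun_sum hf]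
  simp only [_root_.sum_apply, Finset.mul_sum, mul_add, Finset.sum_add_distrib]

theorem wirtingerBar_const_sub {f : ℂ → ℂ} {z : ℂ} (c : ℂ) :
    wirtingerBar (fun w => c - f w) z = - wirtingerBar f z := by
  simp only [wirtingerBar, fderiv_const_sub]
  simp
  ring

/-- The differential of `σ` is complex linear, so the chain rule has no `∂f · ∂̄σ` term. -/
theorem wirtingerBar_comp {f σ : ℂ → ℂ} {z : ℂ} (hf : DifferentiableAt ℝ f (σ z))
    (hσ : DifferentiableAt ℂ σ z) :
    wirtingerBar (fun w => f (σ w)) z = wirtingerBar f (σ z) * conj (deriv σ z) := by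
  have h1 : HasFDerivAt σ ((fderiv ℂ σ z).restrictScalars ℝ) z := hσ.hasFDerivAt.restrictScalars ℝ
  have h2 : fderiv ℝ (fun w => f (σ w)) z =
      (fderiv ℝ f (σ z)).comp ((fderiv ℂ σ z).restrictScalars ℝ) :=
    (hf.hasFDerivAt.comp z h1).fderiv
  -- The differential of `f` is only real linear, so it is expanded in the real basis `1, I`.
  have h3 : ∀ v : ℂ, fderiv ℝ f (σ z) v =
      v.re * fderiv ℝ f (σ z) 1 + v.im * fderiv ℝ f (σ z) Complex.I := by
    intro v
    conv_lhs => rw [show v = v.re • (1 : ℂ) + v.im • Complex.I by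
      simp [Complex.re_add_im]]
    rw [map_add, map_smul, map_smul]
    simp
  have h4 : ∀ v : ℂ, fderiv ℂ σ z v = v * deriv σ z := by
    intro v
    rw [fderiv_eq_smul_deriv, smul_eq_mul]
  simp only [wirtingerBar, h2, ContinuousLinearMap.comp_apply,
    ContinuousLinearMap.coe_restrictScalars', h4]
  rw [h3 (1 * deriv σ z), h3 (Complex.I * deriv σ z)]
  have h5 : conj (deriv σ z) = (deriv σ z).re - (deriv σ z).im * Complex.I := by
    apply Complex.ext <;> simp
  rw [h5]
  simp
  linear_combination (1 / 2 * ((deriv σ z).im : ℂ) * fderiv ℝ f (σ z) Complex.I) * Complex.I_sq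

theorem wirtingerBar_of_differentiableAt {f : ℂ → ℂ} {z : ℂ} (hf : DifferentiableAt ℂ f z) :
    wirtingerBar f z = 0 := by
  have h1 : fderiv ℝ f z = (fderiv ℂ f z).restrictScalars ℝ :=
    (hf.hasFDerivAt.restrictScalars ℝ).fderiv
  simp only [wirtingerBar, h1, ContinuousLinearMap.coe_restrictScalars']
  have : fderiv ℂ f z Complex.I = Complex.I * fderiv ℂ f z 1 := by
    rw [← smul_eq_mul, ← map_smul]; simp
  rw [this]
  linear_combination (1 / 2 * fderiv ℂ f z 1) * Complex.I_sq

theorem ContDiffAt.continuousAt_wirtingerBar {f : ℂ → ℂ} {z : ℂ} (hf : ContDiffAt ℝ 1 f z) :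
    ContinuousAt (wirtingerBar f) z := by
  have h := hf.continuousAt_fderiv (by simp)
  unfold wirtingerBar
  fun_prop

theorem wirtingerBar_div_real {f : ℂ → ℂ} {ε : ℝ} (z : ℂ)
    (hf : Differentiable ℝ f) :
    wirtingerBar (fun w => f (w / ε)) z = wirtingerBar f (z / ε) * (ε⁻¹ : ℝ) := by
  have hd : HasDerivAt (fun w : ℂ => w / ε) (1 / ε) z := (hasDerivAt_id z).div_const _
  rw [wirtingerBar_comp (f := f) (σ := fun w => w / ε) (hf _) hd.differentiableAt, hd.deriv]
  simp

/-! ### Integration by parts on the plane -/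

/-- Integration by parts against the constant function `1`. -/
theorem integral_fderiv_eq_zero_of_hasCompactSupport {f : ℂ → ℂ} (hf : ContDiff ℝ 1 f)
    (hc : HasCompactSupport f) (v : ℂ) : ∫ z, fderiv ℝ f z v = 0 := by
  have hi : Integrable (fun z => fderiv ℝ f z v) :=
    ((hf.continuous_fderiv (by simp)).clm_apply continuous_const).integrable_of_hasCompactSupport
      (hc.fderiv_apply (𝕜 := ℝ) v)
  have := integral_mul_fderiv_eq_neg_fderiv_mul_of_integrable (μ := (volume : Measure ℂ)) (𝕜 := ℂ)
    (f := fun _ : ℂ => (1 : ℂ)) (g := f) (v := v) (by simp) (by simpa using hi)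
    (by simpa using hf.continuous.integrable_of_hasCompactSupport hc)
    (fun x _ => by fun_prop) (fun x _ => (hf.differentiable (by simp)) x)
  simpa using this

theorem integral_wirtingerBar_eq_zero {f : ℂ → ℂ} (hf : ContDiff ℝ 1 f)
    (hc : HasCompactSupport f) : ∫ z, wirtingerBar f z = 0 := by
  have hi : ∀ v, Integrable (fun z => fderiv ℝ f z v) := fun v =>
    ((hf.continuous_fderiv (by simp)).clm_apply continuous_const).integrable_of_hasCompactSupport
      (hc.fderiv_apply (𝕜 := ℝ) v)
  unfold wirtingerBar
  rw [integral_const_mul, integral_add (hi 1) ((hi _).const_mul _), integral_const_mul,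
    integral_fderiv_eq_zero_of_hasCompactSupport hf hc,
    integral_fderiv_eq_zero_of_hasCompactSupport hf hc]
  simp

/-- The values of `f` outside `U` are arbitrary. Cutting `f` off to `K` gives a compactly supported
`C¹` function on the plane that still equals `f` on all of `U`. -/
theorem setIntegral_wirtingerBar_eq_zero {f : ℂ → ℂ} {U K : Set ℂ} (hU : IsOpen U)
    (hK : IsCompact K) (hKU : K ⊆ U) (hf : ∀ z ∈ U, ContDiffAt ℝ 1 f z)
    (h0 : ∀ z ∈ U \ K, f z = 0) : ∫ z in U, wirtingerBar f z = 0 := by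
  have hz : ∀ z ∉ K, K.indicator f =ᶠ[𝓝 z] fun _ => 0 := by
    intro z hzK
    filter_upwards [hK.isClosed.isOpen_compl.mem_nhds hzK] with w hw
    exact indicator_of_notMem hw f
  have heq : ∀ z ∈ U, K.indicator f =ᶠ[𝓝 z] f := by
    intro z hzU
    filter_upwards [hU.mem_nhds hzU] with w hw
    by_cases hwK : w ∈ K
    · exact indicator_of_mem hwK f
    · rw [indicator_of_notMem hwK, h0 w ⟨hw, hwK⟩]
  have hC : ContDiff ℝ 1 (K.indicator f) := by
    rw [contDiff_iff_contDiffAt]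
    intro z
    by_cases hzK : z ∈ K
    · exact (hf z (hKU hzK)).congr_of_eventuallyEq (heq z (hKU hzK))
    · exact contDiffAt_const.congr_of_eventuallyEq (hz z hzK)
  have hs : HasCompactSupport (K.indicator f) :=
    HasCompactSupport.intro hK fun z hzK => indicator_of_notMem hzK f
  rw [setIntegral_congr_fun (g := wirtingerBar (K.indicator f)) hU.measurableSet
    fun z hzU => (wirtingerBar_congr (heq z hzU)).symm,
    setIntegral_eq_integral_of_forall_compl_eq_zero, integral_wirtingerBar_eq_zero hC hs]
  intro z hzU
  rw [wirtingerBar_congr (hz z fun h => hzU (hKU h)), wirtingerBar_const]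

theorem ContinuousOn.integrableOn_of_eq_zero_off_compact {f : ℂ → ℂ} {U K : Set ℂ}
    (hf : ContinuousOn f U) (hU : IsOpen U) (hK : IsCompact K) (hKU : K ⊆ U)
    (h0 : ∀ z ∈ U \ K, f z = 0) : IntegrableOn f U :=
  ((hf.mono hKU).integrableOn_compact hK).of_forall_sdiff_eq_zero hU.measurableSet h0

theorem setIntegral_image_of_holomorphic {σ : ℂ → ℂ} {A : Set ℂ} (hA : MeasurableSet A)
    (hσ : ∀ z ∈ A, DifferentiableAt ℂ σ z) (hinj : InjOn σ A) (g : ℂ → ℂ) :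
    ∫ w in σ '' A, g w = ∫ z in A, g (σ z) * (‖deriv σ z‖ ^ 2 : ℝ) := by
  rw [integral_image_eq_integral_abs_det_fderiv_smul volume hA
    (fun z hz => ((hσ z hz).hasFDerivAt.restrictScalars ℝ).hasFDerivWithinAt) hinj]
  refine setIntegral_congr_fun hA fun z _ => ?_
  have : ((fderiv ℂ σ z).restrictScalars ℝ).det = ‖deriv σ z‖ ^ 2 := by
    have h1 : fderiv ℂ σ z = (deriv σ z) • (1 : ℂ →L[ℂ] ℂ) := by
      ext; simp
    -- The real determinant of multiplication by `σ'` is the norm of `σ'` for the extension `ℂ/ℝ`,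
    -- namely `|σ'|²`.
    have h2 : (((fderiv ℂ σ z).restrictScalars ℝ : ℂ →L[ℝ] ℂ) : ℂ →ₗ[ℝ] ℂ) =
        Algebra.lmul ℝ ℂ (deriv σ z) := by
      rw [h1]; ext; simp
    rw [ContinuousLinearMap.det, h2]
    have := Algebra.norm_complex_apply (deriv σ z)
    rw [Algebra.norm_apply] at this
    rw [Complex.sq_norm]
    exact this
  simp only [this, Complex.real_smul]
  rw [abs_of_nonneg (by positivity), mul_comm]

/-! ### Functions, forms and densities in a holomorphic family of charts -/

/-- A family of charts of a Riemann surface, the chart `e p` being defined at `p`. -/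
structure HolomorphicCharts {N : Type*} [TopologicalSpace N]
    (e : N → OpenPartialHomeomorph N ℂ) : Prop where
  mem_source : ∀ p, p ∈ (e p).source
  analyticAt : ∀ p q x, x ∈ (e p).source → x ∈ (e q).source →
    AnalyticAt ℂ (e q ∘ (e p).symm) (e p x)

section Charts

variable {N : Type*} [TopologicalSpace N] (e : N → OpenPartialHomeomorph N ℂ)

/-- The derivative at `x` of the coordinate change from the chart at `p` to the chart at `q`. -/
def chartJac (p q x : N) : ℂ := deriv (e q ∘ (e p).symm) (e p x)

/-- The Wirtinger derivative of a function at `x` in the chart at `p`. -/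
def chartDbar (p : N) (F : N → ℂ) (x : N) : ℂ := wirtingerBar (F ∘ (e p).symm) (e p x)

/-- Continuous differentiability at `x`, in all charts around `x`. -/
def ChartC1At {E : Type*} [NormedAddCommGroup E] [NormedSpace ℝ E] (F : N → E) (x : N) : Prop :=
  ∀ p, x ∈ (e p).source → ContDiffAt ℝ 1 (F ∘ (e p).symm) (e p x)

/-- `η p x` is the coefficient at `x` of a `(1,0)`-form in the chart at `p`. -/
def IsOneForm (η : N → N → ℂ) : Prop :=
  ∀ p q x, x ∈ (e p).source → x ∈ (e q).source → η p x = η q x * chartJac e p q x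

/-- `ρ p x` is the coefficient at `x` of a density in the chart at `p`. -/
def IsDensity (ρ : N → N → ℂ) : Prop :=
  ∀ p q x, x ∈ (e p).source → x ∈ (e q).source →
    ρ p x = ρ q x * (‖chartJac e p q x‖ ^ 2 : ℝ)

variable {e}

theorem eventually_chart_symm {f : OpenPartialHomeomorph N ℂ} {x : N} (hx : x ∈ f.source)
    {Q : N → Prop} (h : ∀ᶠ y in 𝓝 x, Q y) : ∀ᶠ u in 𝓝 (f x), Q (f.symm u) := by
  have h1 := f.continuousAt_symm (f.map_source hx)
  rw [ContinuousAt, f.left_inv hx] at h1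
  exact h1.eventually h

theorem transition_apply (e : N → OpenPartialHomeomorph N ℂ) {p q x : N}
    (hp : x ∈ (e p).source) : (e q ∘ (e p).symm) (e p x) = e q x := by
  simp [(e p).left_inv hp]

theorem comp_symm_eventuallyEq {E : Type*} (F : N → E) {p q x : N} (hp : x ∈ (e p).source)
    (hq : x ∈ (e q).source) :
    F ∘ (e p).symm =ᶠ[𝓝 (e p x)] fun u => (F ∘ (e q).symm) ((e q ∘ (e p).symm) u) := by
  filter_upwards [eventually_chart_symm hp ((e q).open_source.mem_nhds hq)] with u hu
  simp [(e q).left_inv hu]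

theorem chartJac_comp (he : HolomorphicCharts e) {p q r x : N} (hp : x ∈ (e p).source)
    (hq : x ∈ (e q).source) (hr : x ∈ (e r).source) :
    chartJac e p r x = chartJac e q r x * chartJac e p q x := by
  have h := comp_symm_eventuallyEq (fun y => e r y) hp hq
  unfold chartJac
  rw [show e r ∘ (e p).symm = (fun y => e r y) ∘ (e p).symm from rfl, h.deriv_eq]
  have h1 := (he.analyticAt p q x hp hq).differentiableAt.hasDerivAt
  have h2 := (he.analyticAt q r x hq hr).differentiableAt.hasDerivAt
  rw [← transition_apply e (q := q) hp] at h2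
  have h3 := (h2.comp _ h1).deriv
  rw [transition_apply e hp] at h3
  exact h3

/-! ### Calculus of `C¹` functions in charts -/

namespace ChartC1At

variable {E : Type*} [NormedAddCommGroup E] [NormedSpace ℝ E] {F G : N → E} {x : N}

/-- Coordinate changes are holomorphic, so one chart around the point suffices. -/
theorem of_chart (he : HolomorphicCharts e) {p : N} (hp : x ∈ (e p).source)
    (h : ContDiffAt ℝ 1 (F ∘ (e p).symm) (e p x)) : ChartC1At e F x := by
  intro q hq
  refine ContDiffAt.congr_of_eventuallyEq ?_ (comp_symm_eventuallyEq F hq hp)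
  rw [← transition_apply e (q := p) hq] at h
  exact h.comp _ ((he.analyticAt q p x hq hp).contDiffAt.restrict_scalars ℝ)

theorem congr (h : ChartC1At e F x) (hFG : G =ᶠ[𝓝 x] F) : ChartC1At e G x := fun p hp =>
  (h p hp).congr_of_eventuallyEq (eventually_chart_symm hp hFG)

theorem const (c : E) : ChartC1At e (fun _ => c) x := fun _ _ => contDiffAt_const

theorem sum {t : Finset N} {f : N → N → E} (h : ∀ i ∈ t, ChartC1At e (f i) x) :
    ChartC1At e (fun y => ∑ i ∈ t, f i y) x := fun p hp =>
  ContDiffAt.sum fun i hi => h i hi p hp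

theorem sub (hF : ChartC1At e F x) (hG : ChartC1At e G x) :
    ChartC1At e (fun y => F y - G y) x := fun p hp => (hF p hp).sub (hG p hp)

theorem mul {F G : N → ℂ} (hF : ChartC1At e F x) (hG : ChartC1At e G x) :
    ChartC1At e (fun y => F y * G y) x := fun p hp => (hF p hp).mul (hG p hp)

theorem div {F G : N → ℝ} (hF : ChartC1At e F x) (hG : ChartC1At e G x) (h0 : G x ≠ 0) :
    ChartC1At e (fun y => F y / G y) x := fun p hp =>
  (hF p hp).div (hG p hp) (by simpa [(e p).left_inv hp] using h0)

theorem ofReal {F : N → ℝ} (hF : ChartC1At e F x) : ChartC1At e (fun y => (F y : ℂ)) x :=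
  fun p hp => Complex.ofRealCLM.contDiff.contDiffAt.comp _ (hF p hp)

theorem differentiableAt (hF : ChartC1At e F x) {p : N} (hp : x ∈ (e p).source) :
    DifferentiableAt ℝ (F ∘ (e p).symm) (e p x) := (hF p hp).differentiableAt (by simp)

theorem continuousAt (hF : ChartC1At e F x) {p : N} (hp : x ∈ (e p).source) :
    ContinuousAt F x := by
  have h := ContinuousAt.comp (f := e p) (hF p hp).continuousAt ((e p).continuousAt hp)
  refine h.congr ?_
  filter_upwards [(e p).open_source.mem_nhds hp] with y hy
  simp [(e p).left_inv hy]

theorem continuousAt_chartDbar {F : N → ℂ} (hF : ChartC1At e F x) {p : N}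
    (hp : x ∈ (e p).source) : ContinuousAt (chartDbar e p F) x :=
  ContinuousAt.comp (f := e p) (hF p hp).continuousAt_wirtingerBar ((e p).continuousAt hp)

end ChartC1At

/-! ### The operator `∂̄` in charts and its transformation laws -/

section Dbar

variable {F G : N → ℂ} {p q x : N}

theorem chartDbar_congr (hp : x ∈ (e p).source) (h : F =ᶠ[𝓝 x] G) :
    chartDbar e p F x = chartDbar e p G x :=
  wirtingerBar_congr (eventually_chart_symm hp h)

theorem chartDbar_const (c : ℂ) : chartDbar e p (fun _ => c) x = 0 := wirtingerBar_const _ _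

theorem chartDbar_mul (hp : x ∈ (e p).source) (hF : ChartC1At e F x) (hG : ChartC1At e G x) :
    chartDbar e p (fun y => F y * G y) x = chartDbar e p F x * G x + F x * chartDbar e p G x := by
  have := wirtingerBar_mul (hF.differentiableAt hp) (hG.differentiableAt hp)
  simp only [Function.comp_apply, (e p).left_inv hp] at this
  exact this

theorem chartDbar_sum (hp : x ∈ (e p).source) {t : Finset N} {f : N → N → ℂ}
    (h : ∀ i ∈ t, ChartC1At e (f i) x) :
    chartDbar e p (fun y => ∑ i ∈ t, f i y) x = ∑ i ∈ t, chartDbar e p (f i) x :=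
  wirtingerBar_sum t fun i hi => (h i hi).differentiableAt hp

theorem chartDbar_const_sub (c : ℂ) :
    chartDbar e p (fun y => c - F y) x = - chartDbar e p F x := wirtingerBar_const_sub c

theorem chartDbar_change (he : HolomorphicCharts e) (hp : x ∈ (e p).source)
    (hq : x ∈ (e q).source) (hF : ChartC1At e F x) :
    chartDbar e p F x = chartDbar e q F x * conj (chartJac e p q x) := by
  unfold chartDbar
  rw [wirtingerBar_congr (comp_symm_eventuallyEq F hp hq)]
  have h := hF.differentiableAt hq
  rw [← transition_apply e (q := q) hp] at h
  rw [wirtingerBar_comp h (he.analyticAt p q x hp hq).differentiableAt, transition_apply e hp]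
  rfl

theorem chartJac_comp_symm_eventuallyEq (hp : x ∈ (e p).source) :
    (chartJac e p q) ∘ (e p).symm =ᶠ[𝓝 (e p x)] deriv (e q ∘ (e p).symm) := by
  filter_upwards [(e p).open_target.mem_nhds ((e p).map_source hp)] with u hu
  simp [chartJac, (e p).right_inv hu]

theorem chartC1At_chartJac (he : HolomorphicCharts e) (hp : x ∈ (e p).source)
    (hq : x ∈ (e q).source) : ChartC1At e (chartJac e p q) x :=
  .of_chart he hp (((he.analyticAt p q x hp hq).deriv.contDiffAt.restrict_scalars
    ℝ).congr_of_eventuallyEq (chartJac_comp_symm_eventuallyEq hp))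

theorem IsOneForm.eventuallyEq {η : N → N → ℂ} (hη : IsOneForm e η) (hp : x ∈ (e p).source)
    (hq : x ∈ (e q).source) : η p =ᶠ[𝓝 x] fun y => η q y * chartJac e p q y := by
  filter_upwards [(e p).open_source.mem_nhds hp, (e q).open_source.mem_nhds hq] with y h1 h2
  exact hη p q y h1 h2

/-- The Jacobian `J` of the coordinate change is holomorphic, so `∂̄` does not see it. One factor
`J` comes from the form, one factor `conj J` from the chain rule, and their product is `|J|²`; hence
`∂̄η` can be integrated as a density. -/
theorem chartDbar_oneForm_change (he : HolomorphicCharts e) {η : N → N → ℂ}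
    (hη : IsOneForm e η) (hp : x ∈ (e p).source) (hq : x ∈ (e q).source)
    (hC : ChartC1At e (η q) x) :
    chartDbar e p (η p) x = chartDbar e q (η q) x * (‖chartJac e p q x‖ ^ 2 : ℝ) := by
  have hd := (he.analyticAt p q x hp hq).deriv
  have hJ0 : chartDbar e p (chartJac e p q) x = 0 := by
    unfold chartDbar
    rw [wirtingerBar_congr (chartJac_comp_symm_eventuallyEq hp), wirtingerBar_of_differentiableAt hd.differentiableAt]
  rw [chartDbar_congr hp (hη.eventuallyEq hp hq),
    chartDbar_mul hp hC (chartC1At_chartJac he hp hq), hJ0, chartDbar_change he hp hq hC]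
  have := Complex.conj_mul' (chartJac e p q x)
  push_cast
  linear_combination chartDbar e q (η q) x * this

theorem isDensity_chartDbar_mul (he : HolomorphicCharts e) {η : N → N → ℂ}
    (hη : IsOneForm e η) (hF : ∀ x, ChartC1At e F x) :
    IsDensity e fun p x => chartDbar e p F x * η p x := by
  intro p q x hp hq
  have := Complex.conj_mul' (chartJac e p q x)
  simp only [chartDbar_change he hp hq (hF x), hη p q x hp hq]
  push_cast
  linear_combination chartDbar e q F x * η q x * this

theorem IsOneForm.mul {η : N → N → ℂ} (hη : IsOneForm e η) :
    IsOneForm e fun p x => F x * η p x := fun p q x hp hq => by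
  simp only [hη p q x hp hq, mul_assoc]

end Dbar

/-- The extension by zero of a function of the coordinate at `p` with compact support. -/
theorem chartC1At_indicator [T2Space N] (he : HolomorphicCharts e) {E : Type*}
    [NormedAddCommGroup E] [NormedSpace ℝ E] {p : N} {f : ℂ → E} (hf : ContDiff ℝ 1 f) {K : Set ℂ}
    (hK : IsCompact K) (hKt : K ⊆ (e p).target) (h0 : ∀ u ∉ K, f u = 0) (x : N) :
    ChartC1At e ((e p).source.indicator fun y => f (e p y)) x := by
  by_cases hx : x ∈ (e p).source
  · refine .of_chart he hx (hf.contDiffAt.congr_of_eventuallyEq ?_)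
    filter_upwards [(e p).open_target.mem_nhds ((e p).map_source hx)] with u hu
    simp [indicator, (e p).map_target hu, (e p).right_inv hu]
  · have hKc : IsClosed ((e p).symm '' K) :=
      (hK.image_of_continuousOn ((e p).continuousOn_symm.mono hKt)).isClosed
    refine (ChartC1At.const 0).congr ?_
    have hxK : x ∉ (e p).symm '' K := by
      rintro ⟨u, hu, rfl⟩
      exact hx ((e p).map_target (hKt hu))
    filter_upwards [hKc.isOpen_compl.mem_nhds hxK] with y hy
    by_cases hys : y ∈ (e p).source
    · rw [indicator_of_mem hys]
      exact h0 _ fun h => hy ⟨_, h, (e p).left_inv hys⟩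
    · exact indicator_of_notMem hys _

/-! ### Integration of densities -/

theorem integrableOn_target {p : N} {f : N → ℂ} (hf : ContinuousOn f (e p).source) {K : Set N}
    (hK : IsCompact K) (hKs : K ⊆ (e p).source) (h0 : ∀ x ∉ K, f x = 0) :
    IntegrableOn (fun u => f ((e p).symm u)) (e p).target := by
  refine ContinuousOn.integrableOn_of_eq_zero_off_compact (K := e p '' K)
    (hf.comp (e p).continuousOn_symm fun u hu => (e p).map_target hu) (e p).open_target
    (hK.image_of_continuousOn ((e p).continuousOn.mono hKs)) ?_ ?_
  · rintro _ ⟨x, hx, rfl⟩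
    exact (e p).map_source (hKs hx)
  · rintro u ⟨hu, huK⟩
    exact h0 _ fun h => huK ⟨_, h, (e p).right_inv hu⟩

/-- Both integrals reduce to the overlap of the two charts, where they are related by the change of
variables with Jacobian `|J|²`. -/
theorem IsDensity.setIntegral_target_eq (he : HolomorphicCharts e) {ρ : N → N → ℂ}
    (hρ : IsDensity e ρ) {p q : N} (hp : ∀ x ∈ (e p).source, x ∉ (e q).source → ρ p x = 0)
    (hq : ∀ x ∈ (e q).source, x ∉ (e p).source → ρ q x = 0) :
    ∫ u in (e p).target, ρ p ((e p).symm u) = ∫ u in (e q).target, ρ q ((e q).symm u) := by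
  set τ := (e p).symm.trans (e q) with hτ
  have hs : τ.source = (e p).target ∩ (e p).symm ⁻¹' (e q).source := rfl
  have ht : τ.target = (e q).target ∩ (e q).symm ⁻¹' (e p).source := rfl
  rw [setIntegral_eq_of_subset_of_forall_sdiff_eq_zero (s := τ.source)
    (e p).open_target.measurableSet (hs ▸ inter_subset_left)
    (fun u hu => hp _ ((e p).map_target hu.1) fun h => hu.2 ⟨hu.1, h⟩),
    setIntegral_eq_of_subset_of_forall_sdiff_eq_zero (s := τ.target)
    (e q).open_target.measurableSet (ht ▸ inter_subset_left)
    (fun u hu => hq _ ((e q).map_target hu.1) fun h => hu.2 ⟨hu.1, h⟩),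
    ← τ.image_source_eq_target]
  have han : ∀ u ∈ τ.source, AnalyticAt ℂ τ u := fun u hu => by
    have := he.analyticAt p q ((e p).symm u) ((e p).map_target hu.1) hu.2
    rwa [(e p).right_inv hu.1] at this
  rw [setIntegral_image_of_holomorphic τ.open_source.measurableSet
    (fun u hu => (han u hu).differentiableAt) τ.injOn]
  refine setIntegral_congr_fun τ.open_source.measurableSet fun u hu => ?_
  have h1 := hρ p q ((e p).symm u) ((e p).map_target hu.1) hu.2
  rw [chartJac, (e p).right_inv hu.1] at h1
  have h2 : (e q).symm (τ u) = (e p).symm u := (e q).left_inv hu.2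
  simp only [h2]
  exact h1

/-- A finite partition of unity, `χ i` having compact support in the domain of the chart at `i`. -/
structure ChartPartition (e : N → OpenPartialHomeomorph N ℂ) where
  t : Finset N
  χ : N → N → ℝ
  nonneg : ∀ i ∈ t, ∀ x, 0 ≤ χ i x
  sum_one : ∀ x, ∑ i ∈ t, χ i x = 1
  c1 : ∀ i ∈ t, ∀ x, ChartC1At e (χ i) x
  exists_compact : ∀ i ∈ t, ∃ K, IsCompact K ∧ K ⊆ (e i).source ∧ ∀ x ∉ K, χ i x = 0

/-- Finitely many bump functions, extended by zero from their charts, have a positive sum by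
compactness; they are divided by it. -/
theorem ChartPartition.exists [CompactSpace N] [T2Space N] (he : HolomorphicCharts e) :
    Nonempty (ChartPartition e) := by
  have hR : ∀ i, ∃ R : ℝ, 0 < R ∧ Metric.closedBall (e i i) R ⊆ (e i).target := fun i =>
    Metric.nhds_basis_closedBall.mem_iff.1
      ((e i).open_target.mem_nhds ((e i).map_source (he.mem_source i)))
  choose R hR0 hRt using hR
  let b : ∀ i, ContDiffBump (e i i) := fun i => ⟨R i / 2, R i, half_pos (hR0 i), half_lt_self (hR0 i)⟩
  let f : N → N → ℝ := fun i => (e i).source.indicator fun y => b i (e i y)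
  have hb0 : ∀ i, ∀ u ∉ Metric.closedBall (e i i) (R i), b i u = 0 := fun i u hu =>
    (b i).zero_of_le_dist (le_of_lt (by simpa [b] using hu))
  have hf0 : ∀ i x, 0 ≤ f i x := fun i x => indicator_nonneg (fun y _ => (b i).nonneg) x
  have hfc : ∀ i x, ChartC1At e (f i) x := fun i x =>
    chartC1At_indicator he (b i).contDiff (isCompact_closedBall _ _) (hRt i) (hb0 i) x
  have hpos : ∀ i, ∀ᶠ y in 𝓝 i, 0 < f i y := by
    intro i
    have hc := (hfc i i).continuousAt (he.mem_source i)
    refine hc.eventually (lt_mem_nhds ?_)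
    simp only [f, indicator_of_mem (he.mem_source i)]
    exact (b i).pos_of_mem_ball (Metric.mem_ball_self (hR0 i))
  obtain ⟨t, -, ht⟩ := isCompact_univ.elim_nhds_subcover (fun i => {y | 0 < f i y})
    fun i _ => hpos i
  have hsum : ∀ x, 0 < ∑ i ∈ t, f i x := by
    intro x
    obtain ⟨i, hi, hx⟩ := mem_iUnion₂.1 (ht (mem_univ x))
    exact Finset.sum_pos' (fun j _ => hf0 j x) ⟨i, hi, hx⟩
  refine ⟨⟨t, fun i x => f i x / ∑ j ∈ t, f j x, fun i _ x => div_nonneg (hf0 i x) (hsum x).le,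
    fun x => ?_, fun i _ x => (hfc i x).div (.sum fun j _ => hfc j x) (hsum x).ne', fun i _ => ?_⟩⟩
  · rw [← Finset.sum_div, div_self (hsum x).ne']
  · refine ⟨(e i).symm '' Metric.closedBall (e i i) (R i), (isCompact_closedBall _ _).image_of_continuousOn
      ((e i).continuousOn_symm.mono (hRt i)), ?_, fun x hx => ?_⟩
    · rintro _ ⟨u, hu, rfl⟩
      exact (e i).map_target (hRt i hu)
    · have : f i x = 0 := by
        by_cases hxs : x ∈ (e i).source
        · simp only [f, indicator_of_mem hxs]
          exact hb0 i _ fun h => hx ⟨_, h, (e i).left_inv hxs⟩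
        · simp [f, indicator_of_notMem hxs]
      simp [this]

namespace ChartPartition

variable (B : ChartPartition e)

/-- The integral of a density. -/
def integral (ρ : N → N → ℂ) : ℂ :=
  ∑ i ∈ B.t, ∫ u in (e i).target, (B.χ i ((e i).symm u) : ℂ) * ρ i ((e i).symm u)

variable {B}

theorem continuousOn_χ {i : N} (hi : i ∈ B.t) (p : N) :
    ContinuousOn (fun x => (B.χ i x : ℂ)) (e p).source := fun x hx =>
  ((B.c1 i hi x).ofReal.continuousAt hx).continuousWithinAt

theorem integrableOn {ρ : N → N → ℂ} {i : N} (hi : i ∈ B.t)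
    (hc : ContinuousOn (ρ i) (e i).source) :
    IntegrableOn (fun u => (B.χ i ((e i).symm u) : ℂ) * ρ i ((e i).symm u)) (e i).target := by
  obtain ⟨K, hK, hKs, h0⟩ := B.exists_compact i hi
  exact integrableOn_target (f := fun x => (B.χ i x : ℂ) * ρ i x)
    ((continuousOn_χ hi i).mul hc) hK hKs fun x hx => by simp [h0 x hx]

theorem integral_congr {ρ ρ' : N → N → ℂ} (h : ∀ p, ∀ x ∈ (e p).source, ρ p x = ρ' p x) :
    B.integral ρ = B.integral ρ' :=
  Finset.sum_congr rfl fun i _ => setIntegral_congr_fun (e i).open_target.measurableSet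
    fun u hu => by simp only [h i _ ((e i).map_target hu)]

theorem integral_add {ρ ρ' : N → N → ℂ} (hρ : ∀ p, ContinuousOn (ρ p) (e p).source)
    (hρ' : ∀ p, ContinuousOn (ρ' p) (e p).source) :
    B.integral (fun p x => ρ p x + ρ' p x) = B.integral ρ + B.integral ρ' := by
  unfold integral
  rw [← Finset.sum_add_distrib]
  refine Finset.sum_congr rfl fun i hi => ?_
  simp only [mul_add]
  exact MeasureTheory.integral_add (integrableOn hi (hρ i)) (integrableOn hi (hρ' i))

theorem integral_sum {s : Finset N} {ρ : N → N → N → ℂ}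
    (hρ : ∀ k ∈ s, ∀ p, ContinuousOn (ρ k p) (e p).source) :
    B.integral (fun p x => ∑ k ∈ s, ρ k p x) = ∑ k ∈ s, B.integral (ρ k) := by
  unfold integral
  rw [Finset.sum_comm]
  refine Finset.sum_congr rfl fun i hi => ?_
  simp only [Finset.mul_sum]
  exact integral_finsetSum _ fun k hk => integrableOn hi (hρ k hk i)

/-- Each piece `χ i * ρ` is supported in the overlap of the charts at `i` and `p`, so it may be
integrated in the chart at `p`, where the pieces add up to `ρ`. In particular the partition of unity
does not matter for such `ρ`. -/
theorem integral_eq_setIntegral (he : HolomorphicCharts e) {ρ : N → N → ℂ} (hρ : IsDensity e ρ)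
    {p : N} (hc : ContinuousOn (ρ p) (e p).source) {K : Set N} (hK : IsCompact K)
    (hKs : K ⊆ (e p).source) (h0 : ∀ q, ∀ x ∈ (e q).source, x ∉ K → ρ q x = 0) :
    B.integral ρ = ∫ u in (e p).target, ρ p ((e p).symm u) := by
  have h1 : ∀ i ∈ B.t, ∫ u in (e i).target, (B.χ i ((e i).symm u) : ℂ) * ρ i ((e i).symm u) =
      ∫ u in (e p).target, (B.χ i ((e p).symm u) : ℂ) * ρ p ((e p).symm u) := by
    intro i hi
    obtain ⟨K', hK', hKs', h0'⟩ := B.exists_compact i hi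
    have hd : IsDensity e fun q x => (B.χ i x : ℂ) * ρ q x := fun q q' x hq hq' => by
      simp only [hρ q q' x hq hq', mul_assoc]
    refine hd.setIntegral_target_eq he (fun x hx hxp => ?_) fun x hx hxi => ?_
    · simp [h0 i x hx fun h => hxp (hKs h)]
    · simp [h0' x fun h => hxi (hKs' h)]
  rw [integral, Finset.sum_congr rfl h1, ← integral_finsetSum]
  · refine setIntegral_congr_fun (e p).open_target.measurableSet fun u hu => ?_
    simp only [← Finset.sum_mul]
    rw [← Complex.ofReal_sum, B.sum_one]
    simp
  · intro i hi
    -- Outside the domain of its chart `ρ p` is unconstrained, so it is replaced by zero there to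
    -- obtain a function vanishing off `K` everywhere.
    have := integrableOn_target (f := fun x => (e p).source.indicator
      (fun x => (B.χ i x : ℂ) * ρ p x) x) (p := p)
      (((continuousOn_χ hi p).mul hc).congr fun x hx => indicator_of_mem hx _) hK hKs
      (fun x hx => by
        by_cases hxs : x ∈ (e p).source
        · rw [indicator_of_mem hxs, h0 p x hxs hx, mul_zero]
        · exact indicator_of_notMem hxs _)
    refine this.congr_fun (fun u hu => ?_) (e p).open_target.measurableSet
    exact indicator_of_mem ((e p).map_target hu) _

/-- Stokes' theorem for `(1,0)`-forms on a compact Riemann surface. -/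
theorem integral_chartDbar_eq_zero [T2Space N] (he : HolomorphicCharts e) {η : N → N → ℂ}
    (hη : IsOneForm e η) (hC : ∀ p, ∀ x ∈ (e p).source, ChartC1At e (η p) x) :
    B.integral (fun p => chartDbar e p (η p)) = 0 := by
  have hC' : ∀ i ∈ B.t, ∀ p, ∀ x ∈ (e p).source,
      ChartC1At e (fun y => (B.χ i y : ℂ) * η p y) x := fun i hi p x hx =>
    (B.c1 i hi x).ofReal.mul (hC p x hx)
  have hcont : ∀ i ∈ B.t, ∀ p,
      ContinuousOn (chartDbar e p fun y => (B.χ i y : ℂ) * η p y) (e p).source :=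
    fun i hi p x hx => ((hC' i hi p x hx).continuousAt_chartDbar hx).continuousWithinAt
  -- The form is split as `∑ χ i * η`, which reduces the claim to forms with compact support in a
  -- single chart.
  have h1 : B.integral (fun p => chartDbar e p (η p)) =
      B.integral fun p x => ∑ i ∈ B.t, chartDbar e p (fun y => (B.χ i y : ℂ) * η p y) x := by
    refine integral_congr fun p x hx => ?_
    rw [← chartDbar_sum hx fun i hi => hC' i hi p x hx]
    congr 1
    ext y
    rw [← Finset.sum_mul, ← Complex.ofReal_sum, B.sum_one]
    simp
  rw [h1, integral_sum hcont]
  refine Finset.sum_eq_zero fun i hi => ?_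
  obtain ⟨K, hK, hKs, h0⟩ := B.exists_compact i hi
  have hz : ∀ p, ∀ x ∈ (e p).source, x ∉ K →
      chartDbar e p (fun y => (B.χ i y : ℂ) * η p y) x = 0 := by
    intro p x hx hxK
    rw [chartDbar_congr (G := fun _ => 0) hx, chartDbar_const]
    filter_upwards [hK.isClosed.isOpen_compl.mem_nhds hxK] with y hy
    simp [h0 y hy]
  have hd : IsDensity e fun p => chartDbar e p fun y => (B.χ i y : ℂ) * η p y :=
    fun p q x hp hq => chartDbar_oneForm_change he
      (hη.mul (F := fun y => (B.χ i y : ℂ))) hp hq (hC' i hi q x hq)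
  rw [integral_eq_setIntegral he hd (hcont i hi i) hK hKs hz]
  have h2 := setIntegral_wirtingerBar_eq_zero (f := (fun y => (B.χ i y : ℂ) * η i y) ∘ (e i).symm)
    (e i).open_target (hK.image_of_continuousOn ((e i).continuousOn.mono hKs)) (by
      rintro _ ⟨x, hx, rfl⟩
      exact (e i).map_source (hKs hx))
    (fun u hu => by
      have := hC' i hi i _ ((e i).map_target hu) i ((e i).map_target hu)
      rwa [(e i).right_inv hu] at this)
    (fun u hu => by
      have : (e i).symm u ∉ K := fun h => hu.2 ⟨_, h, (e i).right_inv hu.1⟩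
      simp [h0 _ this])
  rw [← h2]
  refine setIntegral_congr_fun (e i).open_target.measurableSet fun u hu => ?_
  simp only [chartDbar, (e i).right_inv hu]

end ChartPartition

end Charts

/-! ### The residue at an isolated singularity -/

/-- A cut-off function around the origin of the plane. -/
def originBump : ContDiffBump (0 : ℂ) := ⟨1 / 2, 1, by norm_num, by norm_num⟩

/-- The Wirtinger derivative of the cut-off function, divided by the coordinate. -/
def residueKernel (v : ℂ) : ℂ := wirtingerBar (fun w => (originBump w : ℂ)) v / v

theorem contDiff_originBump : ContDiff ℝ 1 fun w => (originBump w : ℂ) :=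
  Complex.ofRealCLM.contDiff.comp originBump.contDiff

theorem wirtingerBar_originBump_of_norm_lt {v : ℂ} (hv : ‖v‖ < 1 / 2) :
    wirtingerBar (fun w => (originBump w : ℂ)) v = 0 := by
  rw [wirtingerBar_congr (g := fun _ => 1), wirtingerBar_const]
  filter_upwards [Metric.isOpen_ball.mem_nhds (mem_ball_zero_iff.2 hv)] with w hw
  rw [originBump.one_of_mem_closedBall (Metric.ball_subset_closedBall hw)]
  simp

theorem wirtingerBar_originBump_of_one_lt_norm {v : ℂ} (hv : 1 < ‖v‖) :
    wirtingerBar (fun w => (originBump w : ℂ)) v = 0 := by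
  rw [wirtingerBar_congr (g := fun _ => 0), wirtingerBar_const]
  filter_upwards [(isOpen_lt continuous_const continuous_norm).mem_nhds hv] with w hw
  rw [originBump.zero_of_le_dist (by simpa [originBump] using le_of_lt hw)]
  simp

theorem continuous_wirtingerBar_originBump :
    Continuous (wirtingerBar fun w => (originBump w : ℂ)) :=
  continuous_iff_continuousAt.2 fun _ => contDiff_originBump.contDiffAt.continuousAt_wirtingerBar

/-- The pole of `1 / v` is harmless: the cut-off is constant for `‖v‖ < 1/2`, so the kernel vanishes
there, and it is supported in the unit disc. -/
theorem integrable_residueKernel : Integrable residueKernel := by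
  refine Continuous.integrable_of_hasCompactSupport (continuous_iff_continuousAt.2 fun v => ?_)
    (HasCompactSupport.intro (isCompact_closedBall (0 : ℂ) 1) fun v hv => ?_)
  · by_cases hv : v = 0
    · subst hv
      refine (continuousAt_const (y := (0 : ℂ))).congr ?_
      filter_upwards [Metric.ball_mem_nhds (0 : ℂ) (by norm_num : (0 : ℝ) < 1 / 2)] with w hw
      rw [residueKernel, wirtingerBar_originBump_of_norm_lt (mem_ball_zero_iff.1 hw), zero_div]
    · exact continuous_wirtingerBar_originBump.continuousAt.div continuousAt_id hv
  · rw [residueKernel, wirtingerBar_originBump_of_one_lt_norm (by simpa using hv), zero_div]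

/-- The substitution `u = ε v` in real dimension two. -/
theorem integral_scaled_residueKernel {E : Type*} [NormedAddCommGroup E] [NormedSpace ℝ E]
    (f : ℂ → E) {ε : ℝ} (hε : 0 < ε) :
    ∫ u : ℂ, (ε⁻¹ ^ 2) • f (u / ε) = ∫ v, f v := by
  have h := Measure.integral_comp_smul (volume : Measure ℂ) f ε⁻¹
  rw [Complex.finrank_real_complex] at h
  have h2 : ∀ u : ℂ, ε⁻¹ • u = u / ε := fun u => by
    rw [Complex.real_smul, Complex.ofReal_inv, div_eq_inv_mul]
  simp only [h2] at h
  rw [integral_smul, h, smul_smul]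
  rw [abs_of_nonneg (by positivity), mul_inv_cancel₀ (by positivity), one_smul]

/-- The integrand is `ε⁻² K(u/ε) * (u F(u))` with `K` the residue kernel. The rescaled kernel keeps
its integral and concentrates on the annulus `ε/2 ≤ |u| ≤ ε`, where `u F(u)` is close to `R`. The
constant `∫ K` is never evaluated, because the application multiplies it by a vanishing sum of
residues. -/
theorem tendsto_setIntegral_wirtingerBar_originBump {F : ℂ → ℂ} {U : Set ℂ} {R : ℂ}
    (hU : IsOpen U) (h0 : (0 : ℂ) ∈ U) (hF : ContinuousOn F (U \ {0}))
    (hR : Tendsto (fun u => u * F u) (𝓝[≠] 0) (𝓝 R)) :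
    Tendsto (fun ε : ℝ => ∫ u in U,
      wirtingerBar (fun w => (originBump (w / ε) : ℂ)) u * F u) (𝓝[>] 0)
      (𝓝 ((∫ v, residueKernel v) * R)) := by
  set M := ∫ v, ‖residueKernel v‖ with hM
  have hM0 : 0 ≤ M := integral_nonneg fun _ => norm_nonneg _
  obtain ⟨ρ, hρ, hρU⟩ := Metric.nhds_basis_closedBall.mem_iff.1 (hU.mem_nhds h0)
  rw [Metric.tendsto_nhds]
  intro δ hδ
  -- The `+ 1` allows `M = 0` and makes the final bound `δ M / (M + 1)` strictly smaller than `δ`.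
  have hδ' : 0 < δ / (M + 1) := by positivity
  obtain ⟨η, hη, hηR⟩ := Metric.mem_nhdsWithin_iff.1
    (Metric.tendsto_nhds.1 hR _ hδ')
  have hmin : 0 < min η ρ := lt_min hη hρ
  filter_upwards [Ioo_mem_nhdsGT hmin] with ε hε
  have hε0 : 0 < ε := hε.1
  have hεη : ε < η := hε.2.trans_le (min_le_left _ _)
  have hερ : ε < ρ := hε.2.trans_le (min_le_right _ _)
  have hεC : (ε : ℂ) ≠ 0 := by exact_mod_cast hε0.ne'
  set k : ℂ → ℂ := fun u => (ε⁻¹ ^ 2) • residueKernel (u / ε) with hk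
  have hnorm : ∀ u : ℂ, ‖u / ε‖ = ‖u‖ / ε := fun u => by
    rw [norm_div, Complex.norm_real, Real.norm_of_nonneg hε0.le]
  have hkint : Integrable k := by
    have := (integrable_residueKernel.comp_smul (R := ε⁻¹) (by positivity)).smul (ε⁻¹ ^ 2)
    refine this.congr (ae_of_all _ fun u => ?_)
    simp only [hk, Pi.smul_apply]
    rw [Complex.real_smul (x := ε⁻¹), Complex.ofReal_inv, div_eq_inv_mul]
  have hkbig : ∀ u : ℂ, ε < ‖u‖ → k u = 0 := fun u hu => by
    simp only [hk, residueKernel]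
    rw [wirtingerBar_originBump_of_one_lt_norm (by rwa [hnorm, one_lt_div hε0]), zero_div,
      smul_zero]
  have hksmall : ∀ u : ℂ, ‖u‖ < ε / 2 → k u = 0 := fun u hu => by
    simp only [hk, residueKernel]
    rw [wirtingerBar_originBump_of_norm_lt (by rw [hnorm, div_lt_iff₀ hε0]; linarith), zero_div,
      smul_zero]
  have hform : ∀ u, wirtingerBar (fun w => (originBump (w / ε) : ℂ)) u * F u = k u * (u * F u) := by
    intro u
    rw [wirtingerBar_div_real (f := fun w => (originBump w : ℂ)) u
      (contDiff_originBump.differentiable (by simp))]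
    simp only [hk, residueKernel, Complex.real_smul]
    by_cases hu : u = 0
    · subst hu
      rw [wirtingerBar_originBump_of_norm_lt (by simp)]
      simp
    · push_cast
      field_simp
  have hcont : ContinuousOn (fun u => wirtingerBar (fun w => (originBump (w / ε) : ℂ)) u * F u)
      U := by
    intro u hu
    by_cases hu0 : u = 0
    · subst hu0
      refine (ContinuousAt.congr (continuousAt_const (y := (0 : ℂ))) ?_).continuousWithinAt
      filter_upwards [Metric.ball_mem_nhds (0 : ℂ) (half_pos hε0)] with w hw
      rw [hform, hksmall w (mem_ball_zero_iff.1 hw), zero_mul]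
    · have h1 : ContinuousAt F u :=
        hF.continuousAt ((hU.sdiff isClosed_singleton).mem_nhds ⟨hu, hu0⟩)
      have h2 : ContDiff ℝ 1 (fun w : ℂ => (originBump (w / ε) : ℂ)) :=
        contDiff_originBump.comp (contDiff_id.div_const _)
      exact (h2.contDiffAt.continuousAt_wirtingerBar.mul h1).continuousWithinAt
  have hint : IntegrableOn (fun u => wirtingerBar (fun w => (originBump (w / ε) : ℂ)) u * F u)
      U := by
    refine hcont.integrableOn_of_eq_zero_off_compact hU (isCompact_closedBall 0 ρ) hρU ?_
    rintro u ⟨-, hu⟩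
    rw [hform, hkbig u (hερ.trans (by simpa using hu)), zero_mul]
  have hkU : ∫ u in U, k u = ∫ v, residueKernel v := by
    rw [setIntegral_eq_integral_of_forall_compl_eq_zero, hk,
      integral_scaled_residueKernel residueKernel hε0]
    intro u hu
    refine hkbig u (hερ.trans ?_)
    by_contra h
    exact hu (hρU (by simpa using h))
  have hkM : ∫ u, ‖k u‖ = M := by
    rw [hM, ← integral_scaled_residueKernel (fun v => ‖residueKernel v‖) hε0]
    congr 1
    ext u
    simp only [hk, norm_smul, smul_eq_mul]
    rw [Real.norm_of_nonneg (by positivity)]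
  rw [dist_eq_norm, ← hkU, ← integral_mul_const, ← integral_sub hint (hkint.integrableOn.mul_const R)]
  have hb : ∀ u, ‖wirtingerBar (fun w => (originBump (w / ε) : ℂ)) u * F u - k u * R‖ ≤
      δ / (M + 1) * ‖k u‖ := by
    intro u
    rw [hform, ← mul_sub, norm_mul, mul_comm]
    by_cases hu : k u = 0
    · simp [hu]
    · refine mul_le_mul_of_nonneg_right ?_ (norm_nonneg _)
      have hu1 : ‖u‖ ≤ ε := not_lt.1 fun h => hu (hkbig u h)
      have hu2 : u ≠ 0 := by
        rintro rfl
        exact hu (hksmall 0 (by simpa using hε0))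
      have := hηR ⟨mem_ball_zero_iff.2 (hu1.trans_lt hεη), hu2⟩
      rw [← dist_eq_norm]
      exact le_of_lt this
  calc ‖∫ u in U, (wirtingerBar (fun w => (originBump (w / ε) : ℂ)) u * F u - k u * R)‖
      ≤ ∫ u in U, δ / (M + 1) * ‖k u‖ :=
        norm_integral_le_of_norm_le (hkint.norm.const_mul _).integrableOn (ae_of_all _ hb)
    _ ≤ ∫ u, δ / (M + 1) * ‖k u‖ :=
        setIntegral_le_integral (hkint.norm.const_mul _)
          (ae_of_all _ fun u => mul_nonneg hδ'.le (norm_nonneg _))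
    _ = δ / (M + 1) * M := by rw [integral_const_mul, hkM]
    _ < δ := by
        rw [div_mul_eq_mul_div, div_lt_iff₀ (by positivity)]
        nlinarith

/-! ### Forms with simple poles whose residues add up to zero -/

section Residue

variable {N : Type*} [TopologicalSpace N] {e : N → OpenPartialHomeomorph N ℂ}

/-- The cut-off function around `p` of radius `ε` in the chart at `p`. -/
def chartCutoff (e : N → OpenPartialHomeomorph N ℂ) (p : N) (ε : ℝ) : N → ℝ :=
  (e p).source.indicator fun x => originBump (e p x / ε)

/-- The closed disc of radius `ε` in the chart at `p`. -/
def chartDisc (e : N → OpenPartialHomeomorph N ℂ) (p : N) (ε : ℝ) : Set N :=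
  (e p).symm '' Metric.closedBall 0 ε

variable {p : N} {ε : ℝ}

theorem isCompact_chartDisc (hε : Metric.closedBall 0 ε ⊆ (e p).target) :
    IsCompact (chartDisc e p ε) :=
  (isCompact_closedBall _ _).image_of_continuousOn ((e p).continuousOn_symm.mono hε)

theorem chartDisc_subset_source (hε : Metric.closedBall 0 ε ⊆ (e p).target) :
    chartDisc e p ε ⊆ (e p).source := by
  rintro _ ⟨u, hu, rfl⟩
  exact (e p).map_target (hε hu)

theorem originBump_div_eq_zero (hε : 0 < ε) {u : ℂ} (hu : u ∉ Metric.closedBall 0 ε) :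
    originBump (u / ε) = 0 := by
  refine originBump.zero_of_le_dist ?_
  have : ε < ‖u‖ := by simpa using hu
  rw [dist_zero_right, norm_div, Complex.norm_real, Real.norm_of_nonneg hε.le]
  exact (one_le_div hε).2 this.le

theorem chartCutoff_eq_zero (hε : 0 < ε) {x : N} (hx : x ∉ chartDisc e p ε) :
    chartCutoff e p ε x = 0 := by
  by_cases hxs : x ∈ (e p).source
  · rw [chartCutoff, indicator_of_mem hxs]
    exact originBump_div_eq_zero hε fun h => hx ⟨_, h, (e p).left_inv hxs⟩
  · exact indicator_of_notMem hxs _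

theorem chartCutoff_le_one (x : N) : chartCutoff e p ε x ≤ 1 :=
  indicator_le' (fun _ _ => originBump.le_one) (fun _ _ => zero_le_one) x

theorem chartC1At_chartCutoff [T2Space N] (he : HolomorphicCharts e) (hε : 0 < ε)
    (ht : Metric.closedBall 0 ε ⊆ (e p).target) (x : N) : ChartC1At e (chartCutoff e p ε) x :=
  chartC1At_indicator he (f := fun u => originBump (u / ε))
    (originBump.contDiff.comp (contDiff_id.div_const _)) (isCompact_closedBall 0 ε) ht
    (fun _ hu => originBump_div_eq_zero hε hu) x

theorem chartCutoff_eventually_eq_one (hε : 0 < ε) (hp : p ∈ (e p).source) (h0 : e p p = 0) :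
    ∀ᶠ x in 𝓝 p, chartCutoff e p ε x = 1 := by
  have h1 := (e p).continuousAt hp
  rw [ContinuousAt, h0] at h1
  filter_upwards [(e p).open_source.mem_nhds hp,
    h1.eventually (Metric.closedBall_mem_nhds (0 : ℂ) (half_pos hε))] with x hx hx2
  rw [chartCutoff, indicator_of_mem hx]
  refine originBump.one_of_mem_closedBall ?_
  rw [dist_zero_right] at hx2
  rw [mem_closedBall_zero_iff]
  rw [norm_div, Complex.norm_real, Real.norm_of_nonneg hε.le, div_le_iff₀ hε]
  simp only [originBump]
  linarith

theorem chartCutoff_eventually_eq_zero [T2Space N] (hε : 0 < ε)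
    (ht : Metric.closedBall 0 ε ⊆ (e p).target) {x : N} (hx : x ∉ chartDisc e p ε) :
    ∀ᶠ y in 𝓝 x, chartCutoff e p ε y = 0 := by
  filter_upwards [(isCompact_chartDisc ht).isClosed.isOpen_compl.mem_nhds hx] with y hy
  exact chartCutoff_eq_zero hε hy

theorem chartDbar_chartCutoff_symm {u : ℂ} (hu : u ∈ (e p).target) :
    chartDbar e p (fun x => (chartCutoff e p ε x : ℂ)) ((e p).symm u) =
      wirtingerBar (fun w => (originBump (w / ε) : ℂ)) u := by
  rw [chartDbar, (e p).right_inv hu]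
  refine wirtingerBar_congr ?_
  filter_upwards [(e p).open_target.mem_nhds hu] with w hw
  simp [chartCutoff, indicator, (e p).map_target hw, (e p).right_inv hw]

/-- The function that is `1` away from the points of `P` and vanishes near them. -/
def chartHole (e : N → OpenPartialHomeomorph N ℂ) (P : Finset N) (ε : ℝ) (x : N) : ℝ :=
  1 - ∑ q ∈ P, chartCutoff e q ε x

/-- The data of a `(1,0)`-form with at most simple poles in `P`. -/
structure PolarForm (e : N → OpenPartialHomeomorph N ℂ) (P : Finset N) (η : N → N → ℂ)
    (R : N → ℂ) : Prop where
  charts : HolomorphicCharts e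
  centred : ∀ p ∈ P, e p p = 0
  isolated : ∀ p, ∀ q ∈ P, q ∈ (e p).source → q = p
  oneForm : IsOneForm e η
  c1 : ∀ x ∉ P, ∀ p, x ∈ (e p).source → ChartC1At e (η p) x
  residue : ∀ p ∈ P, Tendsto (fun u => u * η p ((e p).symm u)) (𝓝[≠] 0) (𝓝 (R p))

namespace PolarForm

variable [T2Space N] {P : Finset N} {η : N → N → ℂ} {R : N → ℂ} (h : PolarForm e P η R)
include h

/-- Near a pole its own cut-off is `1`. The other cut-offs vanish there, since the chart domain at a
pole contains no other pole. -/
theorem chartHole_eventually_eq_zero (hε : 0 < ε)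
    (ht : ∀ q ∈ P, Metric.closedBall 0 ε ⊆ (e q).target) {x : N} (hx : x ∈ P) :
    ∀ᶠ y in 𝓝 x, chartHole e P ε y = 0 := by
  have h1 : ∀ᶠ y in 𝓝 x, ∀ q ∈ P, q ≠ x → chartCutoff e q ε y = 0 := by
    rw [Filter.eventually_all_finset]
    intro q hq
    by_cases hqx : q = x
    · exact Eventually.of_forall fun y hne => absurd hqx hne
    · filter_upwards [chartCutoff_eventually_eq_zero hε (ht q hq) fun hmem =>
        hqx (h.isolated q x hx (chartDisc_subset_source (ht q hq) hmem)).symm] with y hy _ using hy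
  filter_upwards [h1, chartCutoff_eventually_eq_one hε (h.charts.mem_source x) (h.centred x hx)]
    with y hy1 hy2
  rw [chartHole, Finset.sum_eq_single_of_mem x hx fun q hq hne => hy1 q hq hne, hy2, sub_self]

/-- Near every pole each cut-off is locally constant, so its `∂̄` vanishes there and removes the
singularity of `η`. -/
theorem continuousOn_chartDbar_cutoff_mul (hε : 0 < ε)
    (ht : ∀ q ∈ P, Metric.closedBall 0 ε ⊆ (e q).target) {q : N} (hq : q ∈ P) (p : N) :
    ContinuousOn (fun x => chartDbar e p (fun y => (chartCutoff e q ε y : ℂ)) x * η p x)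
      (e p).source := by
  intro x hx
  refine ContinuousAt.continuousWithinAt ?_
  by_cases hxP : x ∈ P
  · have h1 : ∃ c : ℂ, ∀ᶠ y in 𝓝 x, (chartCutoff e q ε y : ℂ) = c := by
      by_cases hqx : q = x
      · subst hqx
        refine ⟨1, ?_⟩
        filter_upwards [chartCutoff_eventually_eq_one hε (h.charts.mem_source q) (h.centred q hq)]
          with y hy
        simp [hy]
      · refine ⟨0, ?_⟩
        filter_upwards [chartCutoff_eventually_eq_zero hε (ht q hq) fun hmem =>
          hqx (h.isolated q x hxP (chartDisc_subset_source (ht q hq) hmem)).symm] with y hy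
        simp [hy]
    obtain ⟨c, hc⟩ := h1
    refine (continuousAt_const (y := (0 : ℂ))).congr ?_
    filter_upwards [hc.eventually_nhds, (e p).open_source.mem_nhds hx] with y hy hyp
    rw [chartDbar_congr hyp hy, chartDbar_const, zero_mul]
  · exact ((chartC1At_chartCutoff h.charts hε (ht q hq) x).ofReal.continuousAt_chartDbar hx).mul
      ((h.c1 x hxP p hx).continuousAt hx)

variable (B : ChartPartition e)

/-- With `ψ` the function with holes, Leibniz gives `ψ ∂̄η = ∂̄(ψη) - (∂̄ψ) η`. The first term
integrates to zero by Stokes, as `ψη` is `C¹` even at the poles; the second is a sum of terms each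
supported in one disc. The continuity statement serves integrability later on. -/
theorem integral_chartHole_mul (hε : 0 < ε)
    (ht : ∀ q ∈ P, Metric.closedBall 0 ε ⊆ (e q).target) :
    (∀ p, ContinuousOn (fun x => (chartHole e P ε x : ℂ) * chartDbar e p (η p) x) (e p).source) ∧
    B.integral (fun p x => (chartHole e P ε x : ℂ) * chartDbar e p (η p) x) =
      ∑ q ∈ P, ∫ u in (e q).target,
        wirtingerBar (fun w => (originBump (w / ε) : ℂ)) u * η q ((e q).symm u) := by
  have hθ : ∀ q ∈ P, ∀ x, ChartC1At e (fun y => (chartCutoff e q ε y : ℂ)) x := fun q hq x =>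
    (chartC1At_chartCutoff h.charts hε (ht q hq) x).ofReal
  have hψe : (fun x => (chartHole e P ε x : ℂ)) =
      fun x => 1 - ∑ q ∈ P, (chartCutoff e q ε x : ℂ) := by
    ext x; simp [chartHole]
  have hψ : ∀ x, ChartC1At e (fun y => (chartHole e P ε y : ℂ)) x := fun x => by
    rw [hψe]
    exact (ChartC1At.const 1).sub (.sum fun q hq => hθ q hq x)
  have hzero : ∀ x ∈ P, ∀ p, (fun y => (chartHole e P ε y : ℂ) * η p y) =ᶠ[𝓝 x] fun _ => 0 := by
    intro x hx p
    filter_upwards [h.chartHole_eventually_eq_zero hε ht hx] with y hy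
    simp [hy]
  have hΩ : ∀ p, ∀ x ∈ (e p).source, ChartC1At e (fun y => (chartHole e P ε y : ℂ) * η p y) x := by
    intro p x hx
    by_cases hxP : x ∈ P
    · exact (ChartC1At.const 0).congr (hzero x hxP p)
    · exact (hψ x).mul (h.c1 x hxP p hx)
  have hdψ : ∀ p, ∀ x ∈ (e p).source, chartDbar e p (fun y => (chartHole e P ε y : ℂ)) x =
      - ∑ q ∈ P, chartDbar e p (fun y => (chartCutoff e q ε y : ℂ)) x := by
    intro p x hx
    rw [hψe, chartDbar_const_sub, chartDbar_sum hx fun q hq => hθ q hq x]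
  have hkey : ∀ p, ∀ x ∈ (e p).source, (chartHole e P ε x : ℂ) * chartDbar e p (η p) x =
      chartDbar e p (fun y => (chartHole e P ε y : ℂ) * η p y) x +
        ∑ q ∈ P, chartDbar e p (fun y => (chartCutoff e q ε y : ℂ)) x * η p x := by
    intro p x hx
    rw [← Finset.sum_mul, ← neg_neg (∑ q ∈ P, _), ← hdψ p x hx]
    -- At a pole `η` need not be differentiable and Leibniz is unavailable, but there every term is
    -- zero because `ψ` vanishes nearby.
    by_cases hxP : x ∈ P
    · have h0 := h.chartHole_eventually_eq_zero hε ht hxP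
      rw [chartDbar_congr hx (hzero x hxP p), chartDbar_const,
        chartDbar_congr (F := fun y => (chartHole e P ε y : ℂ)) (G := fun _ => 0) hx
          (by filter_upwards [h0] with y hy; simp [hy]), chartDbar_const, h0.self_of_nhds]
      simp
    · rw [chartDbar_mul hx (hψ x) (h.c1 x hxP p hx)]
      ring
  have hc1 : ∀ p, ContinuousOn (chartDbar e p fun y => (chartHole e P ε y : ℂ) * η p y)
      (e p).source := fun p x hx => ((hΩ p x hx).continuousAt_chartDbar hx).continuousWithinAt
  have hc2 := fun q hq => h.continuousOn_chartDbar_cutoff_mul hε ht (q := q) hq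
  have hc3 : ∀ p, ContinuousOn (fun x => ∑ q ∈ P,
      chartDbar e p (fun y => (chartCutoff e q ε y : ℂ)) x * η p x) (e p).source := fun p =>
    continuousOn_finsetSum _ fun q hq => hc2 q hq p
  refine ⟨fun p => ((hc1 p).add (hc3 p)).congr (hkey p), ?_⟩
  rw [ChartPartition.integral_congr hkey, ChartPartition.integral_add hc1 hc3,
    ChartPartition.integral_chartDbar_eq_zero h.charts
      (h.oneForm.mul (F := fun y => (chartHole e P ε y : ℂ))) hΩ, zero_add,
    ChartPartition.integral_sum hc2]
  refine Finset.sum_congr rfl fun q hq => ?_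
  rw [ChartPartition.integral_eq_setIntegral h.charts
    (isDensity_chartDbar_mul h.charts h.oneForm (hθ q hq)) (hc2 q hq q)
    (isCompact_chartDisc (ht q hq)) (chartDisc_subset_source (ht q hq))]
  · refine setIntegral_congr_fun (e q).open_target.measurableSet fun u hu => ?_
    simp only [chartDbar_chartCutoff_symm hu]
  · intro p x hx hxK
    rw [chartDbar_congr (G := fun _ => 0) hx, chartDbar_const, zero_mul]
    filter_upwards [chartCutoff_eventually_eq_zero hε (ht q hq) hxK] with y hy
    simp [hy]

theorem tendsto_integral_chartHole_mul :
    Tendsto (fun ε : ℝ => B.integral fun p x => (chartHole e P ε x : ℂ) * chartDbar e p (η p) x)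
      (𝓝[>] 0) (𝓝 ((∫ v, residueKernel v) * ∑ q ∈ P, R q)) := by
  have h0t : ∀ q ∈ P, (0 : ℂ) ∈ (e q).target := fun q hq =>
    h.centred q hq ▸ (e q).map_source (h.charts.mem_source q)
  have hsmall : ∀ᶠ ε : ℝ in 𝓝[>] 0, ∀ q ∈ P, Metric.closedBall 0 ε ⊆ (e q).target := by
    rw [Filter.eventually_all_finset]
    intro q hq
    obtain ⟨ρ, hρ, hρt⟩ := Metric.nhds_basis_closedBall.mem_iff.1
      ((e q).open_target.mem_nhds (h0t q hq))
    filter_upwards [Ioo_mem_nhdsGT hρ] with ε hε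
    exact (Metric.closedBall_subset_closedBall hε.2.le).trans hρt
  rw [Finset.mul_sum]
  refine (tendsto_finsetSum P fun q hq =>
    tendsto_setIntegral_wirtingerBar_originBump (e q).open_target (h0t q hq) ?_
      (h.residue q hq)).congr' ?_
  · intro u hu
    refine ContinuousAt.continuousWithinAt ?_
    have hus := (e q).map_target hu.1
    have hne : (e q).symm u ∉ P := fun hmem => by
      have h1 := h.isolated q _ hmem hus
      have h2 := (e q).right_inv hu.1
      rw [h1, h.centred q hq] at h2
      exact hu.2 h2.symm
    exact ContinuousAt.comp (f := (e q).symm) ((h.c1 _ hne q hus).continuousAt hus)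
      ((e q).continuousAt_symm hu.1)
  · filter_upwards [hsmall, self_mem_nhdsWithin] with ε hε hpos
    exact ((h.integral_chartHole_mul B hpos hε).2).symm

/-- If the residues of a form with simple poles on a compact Riemann surface add up to zero and
`∂̄` of the form has a sign, then the form is holomorphic away from the poles. -/
theorem chartDbar_eq_zero [CompactSpace N] (hR : ∑ q ∈ P, R q = 0)
    (hsign : ∀ x ∉ P, ∃ κ : ℝ, 0 ≤ κ ∧ chartDbar e x (η x) x = -κ) {x₀ : N} (hx₀ : x₀ ∉ P) :
    chartDbar e x₀ (η x₀) x₀ = 0 := by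
  by_contra hne
  obtain ⟨B⟩ := ChartPartition.exists h.charts
  have hlim := h.tendsto_integral_chartHole_mul B
  rw [hR, mul_zero] at hlim
  -- The sign is assumed only in the chart centred at the point; the nonnegative factor `|J|²`
  -- carries it to every chart.
  have hchange : ∀ x ∉ P, ∀ p, x ∈ (e p).source → chartDbar e p (η p) x =
      chartDbar e x (η x) x * (‖chartJac e p x x‖ ^ 2 : ℝ) := fun x hx p hp =>
    chartDbar_oneForm_change h.charts h.oneForm hp (h.charts.mem_source x)
      (h.c1 x hx x (h.charts.mem_source x))
  set κ : N → N → ℝ := fun p x => -(chartDbar e p (η p) x).re with hκ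
  have hκ0 : ∀ x ∉ P, ∀ p, x ∈ (e p).source → 0 ≤ κ p x := by
    intro x hx p hp
    obtain ⟨k, hk, hke⟩ := hsign x hx
    simp only [hκ, hchange x hx p hp, hke, Complex.re_mul_ofReal, Complex.neg_re, Complex.ofReal_re]
    have : 0 ≤ k * ‖chartJac e p x x‖ ^ 2 := by positivity
    linarith
  -- Disjoint neighbourhoods of the poles and of `x₀`: discs inside them do not overlap, which keeps
  -- `chartHole` nonnegative, and they avoid `x₀`.
  obtain ⟨O, hO, hOd⟩ := (P.finite_toSet.insert x₀).t2_separation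
  have hsmall : ∀ᶠ ε : ℝ in 𝓝[>] 0, ∀ q ∈ P,
      Metric.closedBall 0 ε ⊆ (e q).target ∩ (e q).symm ⁻¹' O q := by
    rw [Filter.eventually_all_finset]
    intro q hq
    have h0 := (h.centred q hq)
    have hs := h.charts.mem_source q
    have hmem : (e q).target ∩ (e q).symm ⁻¹' O q ∈ 𝓝 (0 : ℂ) := by
      rw [← h0]
      exact inter_mem ((e q).open_target.mem_nhds ((e q).map_source hs))
        (eventually_chart_symm hs ((hO q).2.mem_nhds (hO q).1))
    obtain ⟨ρ, hρ, hρt⟩ := Metric.nhds_basis_closedBall.mem_iff.1 hmem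
    filter_upwards [Ioo_mem_nhdsGT hρ] with ε hε
    exact (Metric.closedBall_subset_closedBall hε.2.le).trans hρt
  have hdisc : ∀ {ε : ℝ}, (∀ q ∈ P, Metric.closedBall 0 ε ⊆ (e q).target ∩ (e q).symm ⁻¹' O q) →
      ∀ q ∈ P, chartDisc e q ε ⊆ O q := by
    rintro ε hε q hq _ ⟨u, hu, rfl⟩
    exact (hε q hq hu).2
  obtain ⟨ε₀, hε₀, hε₀pos⟩ := (hsmall.and self_mem_nhdsWithin).exists
  have hε₀pos : 0 < ε₀ := hε₀pos
  have ht₀ : ∀ q ∈ P, Metric.closedBall 0 ε₀ ⊆ (e q).target := fun q hq =>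
    (hε₀ q hq).trans inter_subset_left
  -- On `V` the hole function is `1` for every `ε ≤ ε₀`, so the integrand there does not depend on
  -- `ε`.
  set V : Set N := (⋃ q ∈ P, chartDisc e q ε₀)ᶜ with hV
  have hVo : IsOpen V := (P.finite_toSet.isClosed_biUnion fun q hq =>
    (isCompact_chartDisc (ht₀ q hq)).isClosed).isOpen_compl
  have hxV : x₀ ∈ V := by
    simp only [hV, mem_compl_iff, mem_iUnion, not_exists]
    intro q hq hmem
    have hxq : x₀ ≠ q := fun hx => hx₀ (hx ▸ hq)
    exact disjoint_left.1 (hOd (by simp) (by simp [hq]) hxq) (hO x₀).1 (hdisc hε₀ q hq hmem)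
  obtain ⟨i, hi, hχi⟩ : ∃ i ∈ B.t, 0 < B.χ i x₀ := by
    by_contra hcon
    push Not at hcon
    have := Finset.sum_nonpos fun i hi => hcon i hi
    rw [B.sum_one] at this
    linarith
  obtain ⟨K, hK, hKs, hK0⟩ := B.exists_compact i hi
  have hxi : x₀ ∈ (e i).source := hKs (by
    by_contra hx
    exact hχi.ne' (hK0 x₀ hx))
  set W : Set ℂ := (e i).target ∩ (e i).symm ⁻¹' V with hW
  have hWo : IsOpen W := (e i).isOpen_inter_preimage_symm hVo
  set f : ℝ → N → N → ℝ := fun ε j x => B.χ j x * (chartHole e P ε x * κ j x) with hf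
  have hfre : ∀ ε j x, f ε j x =
      -((B.χ j x : ℂ) * ((chartHole e P ε x : ℂ) * chartDbar e j (η j) x)).re := fun ε j x => by
    simp only [hf, hκ, Complex.re_ofReal_mul]
    ring
  have hfint : ∀ ε, 0 < ε → ε ≤ ε₀ → ∀ j ∈ B.t,
      IntegrableOn (fun u => f ε j ((e j).symm u)) (e j).target := by
    intro ε hε hεε j hj
    have ht : ∀ q ∈ P, Metric.closedBall 0 ε ⊆ (e q).target := fun q hq =>
      (Metric.closedBall_subset_closedBall hεε).trans (ht₀ q hq)
    have := (ChartPartition.integrableOn (ρ := fun p x => (chartHole e P ε x : ℂ) *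
      chartDbar e p (η p) x) hj ((h.integral_chartHole_mul B hε ht).1 j)).re.neg
    simp only [hfre]
    exact this
  have hfnonneg : ∀ ε, 0 < ε → ε ≤ ε₀ → ∀ j ∈ B.t, ∀ x ∈ (e j).source, 0 ≤ f ε j x := by
    intro ε hε hεε j hj x hx
    have ht : ∀ q ∈ P, Metric.closedBall 0 ε ⊆ (e q).target ∩ (e q).symm ⁻¹' O q := fun q hq =>
      (Metric.closedBall_subset_closedBall hεε).trans (hε₀ q hq)
    refine mul_nonneg (B.nonneg j hj x) ?_
    by_cases hxP : x ∈ P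
    · rw [(h.chartHole_eventually_eq_zero hε (fun q hq => (ht q hq).trans inter_subset_left)
        hxP).self_of_nhds, zero_mul]
    refine mul_nonneg ?_ (hκ0 x hxP j hx)
    rw [chartHole, sub_nonneg]
    -- At most one cut-off is nonzero at `x`, so their sum is at most `1`.
    by_cases hex : ∃ q ∈ P, x ∈ O q
    · obtain ⟨q, hq, hxq⟩ := hex
      rw [Finset.sum_eq_single_of_mem q hq]
      · exact chartCutoff_le_one x
      · intro q' hq' hne'
        refine chartCutoff_eq_zero hε fun hmem => ?_
        exact disjoint_left.1 (hOd (by simp [hq']) (by simp [hq]) hne')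
          (hdisc ht q' hq' hmem) hxq
    · rw [Finset.sum_eq_zero fun q hq => chartCutoff_eq_zero hε fun hmem =>
        hex ⟨q, hq, hdisc ht q hq hmem⟩]
      exact zero_le_one
  have hfV : ∀ ε, 0 < ε → ε ≤ ε₀ → ∀ x ∈ V, f ε i x = B.χ i x * κ i x := by
    intro ε hε hεε x hx
    have : chartHole e P ε x = 1 := by
      rw [chartHole, Finset.sum_eq_zero, sub_zero]
      intro q hq
      refine chartCutoff_eq_zero hε fun hmem => hx (mem_iUnion₂.2 ⟨q, hq, ?_⟩)
      exact image_mono (Metric.closedBall_subset_closedBall hεε) hmem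
    simp [hf, this]
  -- This integral over a neighbourhood of `x₀` is the lower bound, independent of `ε`, that
  -- contradicts the limit zero.
  have hpos : 0 < ∫ u in W, f ε₀ i ((e i).symm u) := by
    rw [setIntegral_pos_iff_support_of_nonneg_ae]
    · refine Measure.measure_pos_of_mem_nhds volume (x := e i x₀) ?_
      have hx₀V : 0 < f ε₀ i x₀ := by
        rw [hfV ε₀ hε₀pos le_rfl x₀ hxV]
        refine mul_pos hχi (lt_of_le_of_ne (hκ0 x₀ hx₀ i hxi) fun hz => hne ?_)
        obtain ⟨k, hk, hke⟩ := hsign x₀ hx₀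
        have h1 := h.charts.mem_source x₀
        have h2 := chartDbar_oneForm_change h.charts h.oneForm h1 hxi (h.c1 x₀ hx₀ i hxi)
        have h3 : (chartDbar e i (η i) x₀).im = 0 := by
          rw [hchange x₀ hx₀ i hxi, hke, ← Complex.ofReal_neg, ← Complex.ofReal_mul,
            Complex.ofReal_im]
        have h4 : chartDbar e i (η i) x₀ = 0 :=
          Complex.ext (by simp only [hκ] at hz; simp only [Complex.zero_re]; linarith) (by simpa using h3)
        rw [h2, h4, zero_mul]
      have hcf : ContinuousAt (f ε₀ i) x₀ := by
        have h1 := ((ChartPartition.continuousOn_χ hi i).mul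
          ((h.integral_chartHole_mul B hε₀pos ht₀).1 i)).continuousAt
            ((e i).open_source.mem_nhds hxi)
        have h2 : f ε₀ i = fun x => -((B.χ i x : ℂ) *
            ((chartHole e P ε₀ x : ℂ) * chartDbar e i (η i) x)).re := funext fun x => hfre ε₀ i x
        rw [h2]
        exact (Complex.continuous_re.continuousAt.comp h1).neg
      filter_upwards [eventually_chart_symm hxi (hcf.eventually (lt_mem_nhds hx₀V)),
        hWo.mem_nhds ⟨(e i).map_source hxi, by rwa [mem_preimage, (e i).left_inv hxi]⟩] with u hu huW
      exact ⟨ne_of_gt hu, huW⟩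
    · exact ae_restrict_of_forall_mem hWo.measurableSet fun u hu =>
        hfnonneg ε₀ hε₀pos le_rfl i hi _ ((e i).map_target hu.1)
    · exact (hfint ε₀ hε₀pos le_rfl i hi).mono_set inter_subset_left
  -- All contributions are nonnegative, so the total is at least the part of the `i`-th one over
  -- `W`, which is the same for `ε` and `ε₀`.
  have hbound : ∀ ε, 0 < ε → ε ≤ ε₀ → ∫ u in W, f ε₀ i ((e i).symm u) ≤
      -(B.integral fun p x => (chartHole e P ε x : ℂ) * chartDbar e p (η p) x).re := by
    intro ε hε hεε
    have ht : ∀ q ∈ P, Metric.closedBall 0 ε ⊆ (e q).target := fun q hq =>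
      (Metric.closedBall_subset_closedBall hεε).trans (ht₀ q hq)
    have hre : -(B.integral fun p x => (chartHole e P ε x : ℂ) * chartDbar e p (η p) x).re =
        ∑ j ∈ B.t, ∫ u in (e j).target, f ε j ((e j).symm u) := by
      rw [ChartPartition.integral, Complex.re_sum, ← Finset.sum_neg_distrib]
      refine Finset.sum_congr rfl fun j hj => ?_
      have hint := (ChartPartition.integrableOn (ρ := fun p x => (chartHole e P ε x : ℂ) *
        chartDbar e p (η p) x) hj ((h.integral_chartHole_mul B hε ht).1 j))
      have := integral_re hint
      simp only [hfre, integral_neg]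
      rw [← RCLike.re_eq_complex_re, ← this]
    rw [hre]
    have h1 : ∀ j ∈ B.t, 0 ≤ ∫ u in (e j).target, f ε j ((e j).symm u) := fun j hj =>
      setIntegral_nonneg (e j).open_target.measurableSet fun u hu =>
        hfnonneg ε hε hεε j hj _ ((e j).map_target hu)
    refine le_trans ?_ (Finset.single_le_sum h1 hi)
    rw [setIntegral_congr_fun (g := fun u => f ε i ((e i).symm u)) hWo.measurableSet fun u hu => by
      simp only [hfV ε₀ hε₀pos le_rfl _ hu.2, hfV ε hε hεε _ hu.2]]
    exact setIntegral_mono_set (hfint ε hε hεε i hi)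
      (ae_restrict_of_forall_mem (e i).open_target.measurableSet fun u hu =>
        hfnonneg ε hε hεε i hi _ ((e i).map_target hu))
      (Eventually.of_forall (inter_subset_left : W ⊆ _))
  have hlim2 : Tendsto (fun ε : ℝ => -(B.integral fun p x =>
      (chartHole e P ε x : ℂ) * chartDbar e p (η p) x).re) (𝓝[>] 0) (𝓝 0) := by
    simpa using ((Complex.continuous_re.tendsto _).comp hlim).neg
  have hge := ge_of_tendsto hlim2 (by
    filter_upwards [Ioc_mem_nhdsGT hε₀pos] with ε hε using hbound ε hε.1 hε.2)
  linarith

end PolarForm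

end Residue

/-! ### The form defined by a section of a root of the log-canonical bundle -/

section Orbicurve

variable {N C : Type*} [TopologicalSpace N] [ChartedSpace ℂ N]
    [IsManifold 𝓘(ℂ) ω N] [CompactSpace N] [T2Space N]
    [TopologicalSpace C] [ConnectedSpace C] {S : NodalOrbicurve N C}

theorem NodalCurve.finite_special (S : NodalCurve N C) : {p : N | S.IsSpecial p}.Finite := by
  have h : ({z : C | S.IsNode z} ∪ Set.range S.mark).Finite :=
    S.finite_nodes.union (Set.finite_range _)
  refine h.preimage' (f := S.π) fun z _ => ?_
  exact Set.finite_of_encard_le_coe (k := 2) (S.fiber_le_two z)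

theorem NodalOrbicurve.ord_eq_one_of_not_isSpecial {p : N} (hp : ¬ S.IsSpecial p) :
    S.ord (S.π p) = 1 :=
  S.ord_eq_one _ (fun h => hp (.inl h)) fun h => hp (.inr h)

/-! ### Uniformizing charts compared with coordinate charts -/

namespace OrbifoldAtlas

variable (A : OrbifoldAtlas S)

theorem holomorphicCharts : HolomorphicCharts A.chart where
  mem_source := A.mem_source
  analyticAt p q x hp hq := by
    have h := IsManifold.compatible_of_mem_maximalAtlas (A.chart_mem p) (A.chart_mem q)
    rw [contDiffGroupoid, mem_groupoid_of_pregroupoid] at h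
    have h2 : ContDiffOn ℂ ω (A.chart q ∘ (A.chart p).symm)
        ((A.chart p).symm.trans (A.chart q)).source := by
      simpa [contDiffPregroupoid] using h.1
    refine (h2.contDiffAt (((A.chart p).symm.trans (A.chart q)).open_source.mem_nhds ?_)).analyticAt
    exact ⟨(A.chart p).map_source hp, by simpa [(A.chart p).left_inv hp] using hq⟩

variable {A} {p : N} {z : ℂ}

theorem continuousAt_proj (hz : z ∈ A.dom p) : ContinuousAt (A.proj p) z :=
  ContinuousAt.comp (g := (A.chart p).symm) (f := fun w : ℂ => w ^ S.ord (S.π p))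
    ((A.chart p).continuousAt_symm hz) (by fun_prop)

theorem proj_mem_source (hz : z ∈ A.dom p) : A.proj p z ∈ (A.chart p).source :=
  (A.chart p).map_target hz

theorem chart_proj (hz : z ∈ A.dom p) : A.chart p (A.proj p z) = z ^ S.ord (S.π p) :=
  (A.chart p).right_inv hz

theorem isOpen_dom (p : N) : IsOpen (A.dom p) :=
  (A.chart p).open_target.preimage (continuous_pow _)

theorem eventually_mem_regDom (hz : z ∈ A.regDom p) : ∀ᶠ w in 𝓝 z, w ∈ A.regDom p := by
  have h1 := (continuousAt_proj hz.1).eventually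
    (S.finite_special.isClosed.isOpen_compl.mem_nhds hz.2)
  filter_upwards [(isOpen_dom p).mem_nhds hz.1, h1] with w hw hw2 using ⟨hw, hw2⟩

theorem mem_dom_of_not_isSpecial (hp : ¬ S.IsSpecial p) : z ∈ A.dom p ↔ z ∈ (A.chart p).target := by
  simp [dom, S.ord_eq_one_of_not_isSpecial hp]

theorem proj_of_not_isSpecial (hp : ¬ S.IsSpecial p) : A.proj p z = (A.chart p).symm z := by
  simp [proj, S.ord_eq_one_of_not_isSpecial hp]

theorem chart_eq_zero_of_isSpecial {q : N} (hq : q ∈ (A.chart p).source) (hs : S.IsSpecial q) :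
    A.chart p q = 0 := by
  rw [A.special_eq p q hq hs, A.chart_self]

theorem zero_mem_target (A : OrbifoldAtlas S) (p : N) : (0 : ℂ) ∈ (A.chart p).target :=
  A.chart_self p ▸ (A.chart p).map_source (A.mem_source p)

theorem mem_regDom_of_pow_eq {u : ℂ} (hu : u ∈ (A.chart p).target)
    (h : ¬ S.IsSpecial ((A.chart p).symm u)) (hz : z ^ S.ord (S.π p) = u) : z ∈ A.regDom p := by
  subst hz
  exact ⟨hu, h⟩

theorem not_isSpecial_symm {u : ℂ} (hu : u ∈ (A.chart p).target) (hu0 : u ≠ 0) :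
    ¬ S.IsSpecial ((A.chart p).symm u) := fun hs => hu0 (by
  rw [← (A.chart p).right_inv hu]
  exact chart_eq_zero_of_isSpecial ((A.chart p).map_target hu) hs)

/-- The coordinate change from the uniformizing chart at `p` to the chart at a regular point `q`. -/
def toChart (A : OrbifoldAtlas S) (p q : N) (z : ℂ) : ℂ := A.chart q (A.proj p z)

theorem hasDerivAt_toChart {q : N} (hz : z ∈ A.dom p) (hq : A.proj p z ∈ (A.chart q).source) :
    HasDerivAt (A.toChart p q) (chartJac A.chart p q (A.proj p z) *
      (S.ord (S.π p) * z ^ (S.ord (S.π p) - 1))) z := by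
  have h1 := (A.holomorphicCharts.analyticAt p q _ (proj_mem_source hz) hq).differentiableAt.hasDerivAt
  have h2 := hasDerivAt_pow (S.ord (S.π p)) z
  rw [chart_proj hz] at h1
  have h3 := HasDerivAt.comp z h1 h2
  rw [chartJac, chart_proj hz]
  exact h3

/-- At a regular `q` the local group is trivial, so the uniformizing chart is the coordinate itself
and no root has to be chosen. -/
theorem isTransition_toChart {q : N} (hz : z ∈ A.regDom p) (hq : ¬ S.IsSpecial q)
    (hzq : A.proj p z ∈ (A.chart q).source) : A.IsTransition p q (A.toChart p q) z := by
  constructor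
  · have h1 := A.holomorphicCharts.analyticAt p q _ (proj_mem_source hz.1) hzq
    rw [chart_proj hz.1] at h1
    exact AnalyticAt.comp (f := fun w : ℂ => w ^ S.ord (S.π p)) h1 (by fun_prop)
  · filter_upwards [eventually_mem_regDom hz, (continuousAt_proj hz.1).eventually
      ((A.chart q).open_source.mem_nhds hzq)] with w hw hwq
    have h2 : A.proj q (A.toChart p q w) = A.proj p w := by
      rw [proj_of_not_isSpecial hq, toChart, (A.chart q).left_inv hwq]
    exact ⟨hw, ⟨(mem_dom_of_not_isSpecial hq).2 ((A.chart q).map_source hwq),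
      by rw [h2]; exact hw.2⟩, h2.symm⟩

end OrbifoldAtlas

variable {L : OrbifoldLineBundle S}

theorem OrbifoldLineBundle.d_eq_zero_of_not_isSpecial {p : N} (hp : ¬ S.IsSpecial p) :
    L.d p = 0 := by
  have := L.d_lt p
  rw [S.ord_eq_one_of_not_isSpecial hp] at this
  omega

/-- Being Ramond is a property of the node: `m` divides `d p + d q`, and `d q < m`. -/
theorem OrbifoldLineBundle.d_eq_zero_of_node {p q : N} (hne : p ≠ q) (hpq : S.π p = S.π q)
    (hp : L.d p = 0) : L.d q = 0 := by
  have h := L.balanced p q hne hpq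
  rw [hp, zero_add, hpq] at h
  exact Nat.eq_zero_of_dvd_of_lt h (L.d_lt q)

theorem NodalOrbicurve.ord_ne_zero (S : NodalOrbicurve N C) (z : C) : S.ord z ≠ 0 :=
  Nat.one_le_iff_ne_zero.1 (S.one_le_ord z)

theorem klogCoeff_of_not_isSpecial {p : N} (hp : ¬ S.IsSpecial p) (z : ℂ) :
    klogCoeff S p z = 1 := by simp [klogCoeff, hp]

/-! ### The form `φ(s ^ r)`, its residues, and the conclusion -/

namespace DesingSection

variable {r : ℕ} (s : DesingSection L) (φ : LogCanonicalRoot L r)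

theorem continuousOn_g (p : N) : ContinuousOn (s.g p) (L.atlas.chart p).target := by
  by_cases h : L.IsRamondNode p
  · exact s.continuous_ramond p h
  · exact (s.smooth p h).continuousOn

theorem rep_of_not_isSpecial {p : N} (hp : ¬ S.IsSpecial p) : s.rep p = s.g p := by
  ext z
  simp [rep, S.ord_eq_one_of_not_isSpecial hp, L.d_eq_zero_of_not_isSpecial hp]

/-- The image of `s ^ r` under `φ`, as a `(1,0)`-form on the components: the coefficient at `x` in
the chart at `p` is obtained from the chart at `x`. -/
def logForm (p x : N) : ℂ := φ.a x 0 * s.g x 0 ^ r * chartJac L.atlas.chart p x x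

theorem isOneForm_logForm : IsOneForm L.atlas.chart (s.logForm φ) := by
  intro p q x hp hq
  simp only [logForm]
  rw [chartJac_comp L.atlas.holomorphicCharts hp hq (L.atlas.mem_source x)]
  ring

/-- Passing to the chart at the regular point below `z`, the factor `T ^ r` from `φ` is absorbed by
the transformation of `s ^ r`. The remaining factor is `du = m z ^ (m-1) dz` for `u = z ^ m`. -/
theorem logForm_proj {p : N} {z : ℂ} (hz : z ∈ L.atlas.regDom p) :
    φ.a p z * klogCoeff S p z * s.rep p z ^ r =
      s.logForm φ p (L.atlas.proj p z) * (S.ord (S.π p) * z ^ (S.ord (S.π p) - 1)) := by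
  set x := L.atlas.proj p z with hx
  have hxs : ¬ S.IsSpecial x := hz.2
  have hσ := OrbifoldAtlas.isTransition_toChart hz hxs (L.atlas.mem_source x)
  have h0 : L.atlas.toChart p x z = 0 := L.atlas.chart_self x
  have h1 := φ.compatible p x _ z hσ
  have h2 := s.compatible p x z _ hσ.2.self_of_nhds
  rw [h0, klogCoeff_of_not_isSpecial hxs,
    (OrbifoldAtlas.hasDerivAt_toChart hz.1 (L.atlas.mem_source x)).deriv] at h1
  rw [h0, L.d_eq_zero_of_not_isSpecial hxs, S.ord_eq_one_of_not_isSpecial hxs] at h2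
  simp only [pow_zero, one_mul, pow_one] at h2
  rw [h1, logForm, h2, rep]
  ring

theorem logForm_of_not_isSpecial {p x : N} (hp : ¬ S.IsSpecial p)
    (hx : x ∈ (L.atlas.chart p).source) :
    s.logForm φ p x = φ.a p (L.atlas.chart p x) * s.g p (L.atlas.chart p x) ^ r := by
  have hd : L.atlas.chart p x ∈ L.atlas.dom p :=
    (OrbifoldAtlas.mem_dom_of_not_isSpecial hp).2 ((L.atlas.chart p).map_source hx)
  have hpr : L.atlas.proj p (L.atlas.chart p x) = x := by
    rw [OrbifoldAtlas.proj_of_not_isSpecial hp, (L.atlas.chart p).left_inv hx]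
  have h := s.logForm_proj φ (z := L.atlas.chart p x) ⟨hd, by
    rw [hpr]
    exact fun hs => hp (L.atlas.special_eq p x hx hs ▸ hs)⟩
  rw [hpr, klogCoeff_of_not_isSpecial hp, s.rep_of_not_isSpecial hp,
    S.ord_eq_one_of_not_isSpecial hp] at h
  simpa using h.symm

theorem logForm_comp_symm_eventuallyEq {p x : N} (hp : ¬ S.IsSpecial p)
    (hx : x ∈ (L.atlas.chart p).source) :
    s.logForm φ p ∘ (L.atlas.chart p).symm =ᶠ[𝓝 (L.atlas.chart p x)]
      fun u => φ.a p u * s.g p u ^ r := by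
  filter_upwards [(L.atlas.chart p).open_target.mem_nhds ((L.atlas.chart p).map_source hx)]
    with u hu
  rw [Function.comp_apply, s.logForm_of_not_isSpecial φ hp ((L.atlas.chart p).map_target hu),
    (L.atlas.chart p).right_inv hu]

theorem contDiffAt_g {p : N} (hp : ¬ S.IsSpecial p) {u : ℂ} (hu : u ∈ (L.atlas.chart p).target) :
    ContDiffAt ℝ 1 (s.g p) u :=
  (((s.smooth p fun h => hp (.inl h.1)).contDiffAt
    ((L.atlas.chart p).open_target.mem_nhds hu))).of_le (by norm_cast)

theorem analyticAt_a {p : N} (hp : ¬ S.IsSpecial p) {u : ℂ}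
    (hu : u ∈ (L.atlas.chart p).target) : AnalyticAt ℂ (φ.a p) u :=
  φ.holomorphic p u ((OrbifoldAtlas.mem_dom_of_not_isSpecial hp).2 hu)

/-- The chart at `p` may be centred at a special point, so regularity is checked in the chart at
`x`, where the coefficient is `a * g ^ r`. -/
theorem chartC1At_logForm {x : N} (hx : ¬ S.IsSpecial x) (p : N)
    (hp : x ∈ (L.atlas.chart p).source) : ChartC1At L.atlas.chart (s.logForm φ p) x := by
  have hxx := L.atlas.mem_source x
  have ht := (L.atlas.chart x).map_source hxx
  refine ChartC1At.congr ?_ ((s.isOneForm_logForm φ).eventuallyEq hp hxx)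
  refine .mul (.of_chart L.atlas.holomorphicCharts hxx ?_)
    (chartC1At_chartJac L.atlas.holomorphicCharts hp hxx)
  refine ContDiffAt.congr_of_eventuallyEq ?_ (s.logForm_comp_symm_eventuallyEq φ hx hxx)
  exact ((analyticAt_a φ hx ht).contDiffAt.restrict_scalars ℝ).mul ((s.contDiffAt_g hx ht).pow r)

/-- `∂̄` of the form `φ (s ^ r)` for a solution of the spin equation. -/
theorem chartDbar_logForm {H : HermitianMetric L} (hs : s.SpinEquation φ H) {x : N}
    (hx : ¬ S.IsSpecial x) :
    chartDbar L.atlas.chart x (s.logForm φ x) x =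
      -((r * (‖φ.a x 0 * s.g x 0 ^ (r - 1)‖ ^ 2 / H.h x 0) : ℝ) : ℂ) := by
  have hxx := L.atlas.mem_source x
  have h0 := L.atlas.zero_mem_target x
  have hd := (s.contDiffAt_g hx h0).differentiableAt (by simp)
  have ha := (analyticAt_a φ hx h0).differentiableAt
  have hreg : (0 : ℂ) ∈ L.atlas.regDom x := by
    refine ⟨(OrbifoldAtlas.mem_dom_of_not_isSpecial hx).2 h0, ?_⟩
    rwa [OrbifoldAtlas.proj_of_not_isSpecial hx, ← L.atlas.chart_self x,
      (L.atlas.chart x).left_inv hxx]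
  have hsp := hs x 0 hreg
  rw [dbarCoeff, conjPowCoeff, s.rep_of_not_isSpecial hx, klogCoeff_of_not_isSpecial hx,
    mul_one] at hsp
  rw [chartDbar, wirtingerBar_congr (s.logForm_comp_symm_eventuallyEq φ hx hxx),
    L.atlas.chart_self, wirtingerBar_mul (g := fun u => s.g x u ^ r) (ha.restrictScalars ℝ) (hd.pow r),
    wirtingerBar_of_differentiableAt ha, wirtingerBar_pow hd, eq_neg_of_add_eq_zero_left hsp]
  -- After the spin equation is inserted, `a g ^ (r-1)` meets its own conjugate.
  have := Complex.mul_conj' (φ.a x 0 * s.g x 0 ^ (r - 1))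
  push_cast
  linear_combination (-r / (H.h x 0 : ℂ)) * this

/-- The residue at `p` of the form `φ (s ^ r)`. -/
def residue (p : N) : ℂ :=
  φ.a p 0 * s.rep p 0 ^ r / S.ord (S.π p)

/-- Upstairs the form is `a * rep ^ r dz/z`, and `du/u = m dz/z`, so `u η` equals `a * rep ^ r / m`
evaluated at a root `z` of `z ^ m = u`. This is continuous at `z = 0`, even at Ramond nodes. -/
theorem tendsto_residue {p : N} (hp : S.IsSpecial p) :
    Tendsto (fun u => u * s.logForm φ p ((L.atlas.chart p).symm u)) (𝓝[≠] 0)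
      (𝓝 (s.residue φ p)) := by
  set m := S.ord (S.π p) with hm_def
  have hm : m ≠ 0 := S.ord_ne_zero _
  have hmC : (m : ℂ) ≠ 0 := Nat.cast_ne_zero.2 hm
  have h0 := L.atlas.zero_mem_target p
  -- The principal root jumps along the negative axis, but only its limit at `0` is needed.
  have hroot : Tendsto (fun u : ℂ => u ^ (m⁻¹ : ℂ)) (𝓝[≠] 0) (𝓝 0) := by
    have h1 : ContinuousAt (fun u : ℂ => u ^ (m⁻¹ : ℂ)) 0 :=
      Complex.continuousAt_cpow_const_of_re_pos (.inl le_rfl) (by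
        rw [← Complex.ofReal_natCast, ← Complex.ofReal_inv, Complex.ofReal_re]
        exact inv_pos.2 (Nat.cast_pos.2 (Nat.pos_of_ne_zero hm)))
    have h2 := h1.tendsto
    rw [Complex.zero_cpow (inv_ne_zero hmC)] at h2
    exact h2.mono_left nhdsWithin_le_nhds
  have hrep : ContinuousAt (s.rep p) 0 := by
    have hg : ContinuousAt (s.g p) ((0 : ℂ) ^ m) := by
      rw [zero_pow hm]
      exact (s.continuousOn_g p).continuousAt ((L.atlas.chart p).open_target.mem_nhds h0)
    exact ContinuousAt.mul (by fun_prop)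
      (ContinuousAt.comp (f := fun z : ℂ => z ^ m) hg (by fun_prop))
  have ha : ContinuousAt (φ.a p) 0 := (φ.holomorphic p 0 (by
    rwa [OrbifoldAtlas.dom, mem_ofPred, zero_pow (S.ord_ne_zero _)])).continuousAt
  have hG : ContinuousAt (fun z => φ.a p z * s.rep p z ^ r / m) 0 :=
    (ha.mul (hrep.pow r)).div_const _
  refine (hG.tendsto.comp hroot).congr' ?_
  filter_upwards [self_mem_nhdsWithin,
    nhdsWithin_le_nhds ((L.atlas.chart p).open_target.mem_nhds h0)] with u hu0 hu
  have hz : (u ^ (m⁻¹ : ℂ)) ^ m = u := Complex.cpow_nat_inv_pow u hm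
  simp only [Function.comp_apply]
  set z := u ^ (m⁻¹ : ℂ)
  have hz0 : z ≠ 0 := by
    rintro h
    rw [h, zero_pow hm] at hz
    exact hu0 hz.symm
  have hkey := s.logForm_proj φ (OrbifoldAtlas.mem_regDom_of_pow_eq hu
    (OrbifoldAtlas.not_isSpecial_symm hu hu0) hz)
  rw [OrbifoldAtlas.proj, hz, klogCoeff, if_pos hp, ← hm_def] at hkey
  have hpow : u = z * z ^ (m - 1) := by
    rw [← pow_succ', Nat.sub_add_cancel (Nat.one_le_iff_ne_zero.2 hm), hz]
  have hkey' : φ.a p z * s.rep p z ^ r =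
      z * (s.logForm φ p ((L.atlas.chart p).symm u) * (m * z ^ (m - 1))) := by
    rw [← hkey]
    field_simp
  rw [hkey', div_eq_iff hmC]
  nth_rewrite 2 [hpow]
  ring

theorem rep_zero_of_pos {p : N} (hp : L.d p ≠ 0) : s.rep p 0 = 0 := by
  simp [rep, hp]

theorem rep_zero_of_d_eq_zero {p : N} (hp : L.d p = 0) : s.rep p 0 = s.g p 0 := by
  simp [rep, hp, S.ord_ne_zero]

/-- At a Ramond node the orders and the values of `s` agree on both branches while `a` changes sign.
At a Neveu-Schwarz node both residues vanish separately, because of the factor `z ^ d`. -/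
theorem residue_add_residue {p q : N} (hr : r ≠ 0) (hne : p ≠ q) (hpq : S.π p = S.π q)
    (hp : S.IsNode (S.π p)) : s.residue φ p + s.residue φ q = 0 := by
  unfold residue
  by_cases hd : L.d p = 0
  · rw [s.rep_zero_of_d_eq_zero hd, s.rep_zero_of_d_eq_zero (L.d_eq_zero_of_node hne hpq hd),
      φ.node p q hne hpq, s.node p q hne hpq ⟨hp, hd⟩, hpq]
    ring
  · rw [s.rep_zero_of_pos hd, s.rep_zero_of_pos fun h =>
      hd (L.d_eq_zero_of_node hne.symm hpq.symm h)]
    simp [hr]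

-- Special points are grouped by their image in the curve: over a marked point every residue is
-- zero, over a node the two residues cancel.
open Classical in
theorem sum_residue_eq_zero (hr : r ≠ 0) (hNS : ∀ p, S.IsMarked (S.π p) → L.IsNeveuSchwarz p) :
    ∑ p ∈ S.finite_special.toFinset, s.residue φ p = 0 := by
  rw [← Finset.sum_fiberwise_of_maps_to (g := S.π)
    (t := S.finite_special.toFinset.image S.π) fun p hp => Finset.mem_image_of_mem _ hp]
  refine Finset.sum_eq_zero fun c hc => ?_
  by_cases hcm : S.IsMarked c
  · refine Finset.sum_eq_zero fun p hp => ?_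
    obtain ⟨-, rfl⟩ := Finset.mem_filter.1 hp
    rw [residue, s.rep_zero_of_pos (hNS p hcm).2.ne', zero_pow hr, mul_zero, zero_div]
  · obtain ⟨p, hp, rfl⟩ := Finset.mem_image.1 hc
    have hnode : S.IsNode (S.π p) := by
      rcases (S.finite_special.mem_toFinset.1 hp) with h | h
      exacts [h, absurd h hcm]
    obtain ⟨x, y, hxy, hfib⟩ := Set.encard_eq_two.1 hnode
    have hmem : ∀ z, S.π z = S.π p ↔ z = x ∨ z = y := fun z => by
      have := Set.ext_iff.1 hfib z
      simpa using this
    have hx := (hmem x).2 (.inl rfl)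
    have hy := (hmem y).2 (.inr rfl)
    have hfilter : {z ∈ S.finite_special.toFinset | S.π z = S.π p} = {x, y} := by
      ext z
      rw [Finset.mem_filter, hmem, S.finite_special.mem_toFinset, Finset.mem_insert,
        Finset.mem_singleton]
      refine and_iff_right_of_imp ?_
      rintro (rfl | rfl)
      · exact .inl (hx ▸ hnode)
      · exact .inl (hy ▸ hnode)
    rw [hfilter, Finset.sum_pair hxy]
    exact s.residue_add_residue φ hr hxy (hx.trans hy.symm) (hx ▸ hnode)

theorem polarForm_logForm : PolarForm L.atlas.chart S.finite_special.toFinset (s.logForm φ)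
    (s.residue φ) where
  charts := L.atlas.holomorphicCharts
  centred p _ := L.atlas.chart_self p
  isolated p q hq hqp := L.atlas.special_eq p q hqp (S.finite_special.mem_toFinset.1 hq)
  oneForm := s.isOneForm_logForm φ
  c1 _ hx := s.chartC1At_logForm φ fun h => hx (S.finite_special.mem_toFinset.2 h)
  residue _ hp := s.tendsto_residue φ (S.finite_special.mem_toFinset.1 hp)

/-- The residue argument forces `r |a g ^ (r-1)|² / h = 0` at `x`, and `r`, `a`, `h` and `r - 1` are
nonzero. Evaluation at the centre of its own chart suffices, as every regular point has one. -/
theorem g_zero_eq_zero_of_spinEquation {H : HermitianMetric L} (hr : 2 ≤ r)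
    (hNS : ∀ p, S.IsMarked (S.π p) → L.IsNeveuSchwarz p) (hs : s.SpinEquation φ H) {x : N}
    (hx : ¬ S.IsSpecial x) : s.g x 0 = 0 := by
  have hreg : ∀ {y : N}, ¬ S.IsSpecial y → (0 : ℂ) ∈ L.atlas.regDom y := fun {y} hy => by
    refine OrbifoldAtlas.mem_regDom_of_pow_eq (L.atlas.zero_mem_target y) ?_
      (zero_pow (S.ord_ne_zero _))
    rwa [← L.atlas.chart_self y, (L.atlas.chart y).left_inv (L.atlas.mem_source y)]
  have h := (s.polarForm_logForm φ).chartDbar_eq_zero (s.sum_residue_eq_zero φ (by omega) hNS)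
    (fun y hy => ?_) (x₀ := x) (by simpa using hx)
  · rw [s.chartDbar_logForm φ hs hx] at h
    have hH := H.pos x 0 (hreg hx)
    have ha := φ.ne_zero x 0 (hreg hx).1
    have hr0 : r ≠ 0 := by omega
    simpa [hr0, hH.ne', ha, show r - 1 ≠ 0 by omega] using h
  · have hy' : ¬ S.IsSpecial y := by simpa using hy
    refine ⟨_, ?_, s.chartDbar_logForm φ hs hy'⟩
    have hH := H.pos y 0 (hreg hy')
    positivity

theorem isZero_of_spinEquation {H : HermitianMetric L} (hr : 2 ≤ r)
    (hNS : ∀ p, S.IsMarked (S.π p) → L.IsNeveuSchwarz p) (hs : s.SpinEquation φ H) :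
    s.IsZero := by
  have hns : ∀ p, ∀ u ∈ (L.atlas.chart p).target, ¬ S.IsSpecial ((L.atlas.chart p).symm u) →
      s.g p u = 0 := by
    intro p u hu hus
    have hm := S.ord_ne_zero (S.π p)
    -- Any root will do: it serves to transfer the vanishing from the chart at the point over `u` to
    -- the chart at `p`.
    obtain ⟨z, hz⟩ : ∃ z : ℂ, z ^ S.ord (S.π p) = u := ⟨_, Complex.cpow_nat_inv_pow u hm⟩
    have hreg := OrbifoldAtlas.mem_regDom_of_pow_eq hu hus hz
    have hz0 : S.IsSpecial p → z ≠ 0 := by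
      rintro hp rfl
      rw [zero_pow hm] at hz
      rw [← hz, ← L.atlas.chart_self p, (L.atlas.chart p).left_inv (L.atlas.mem_source p)] at hus
      exact hus hp
    have hkl : klogCoeff S p z ≠ 0 := by
      unfold klogCoeff
      split_ifs with hp
      exacts [inv_ne_zero (hz0 hp), one_ne_zero]
    have hzd : z ^ L.d p ≠ 0 := by
      by_cases hp : S.IsSpecial p
      · exact pow_ne_zero _ (hz0 hp)
      · simp [L.d_eq_zero_of_not_isSpecial hp]
    have hkey := s.logForm_proj φ hreg
    rw [OrbifoldAtlas.proj, hz, logForm, s.g_zero_eq_zero_of_spinEquation φ hr hNS hs hus,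
      zero_pow (by omega), mul_zero, zero_mul, zero_mul] at hkey
    have hrep := pow_eq_zero_iff (by omega : r ≠ 0) |>.1
      ((mul_eq_zero.1 hkey).resolve_left (mul_ne_zero (φ.ne_zero p z hreg.1) hkl))
    rw [rep, hz] at hrep
    exact (mul_eq_zero.1 hrep).resolve_left hzd
  intro p u hu
  -- Only the centre of a chart can be special, and there the value is a limit of zeros.
  by_cases hu0 : u = 0
  · subst hu0
    have h1 : Tendsto (s.g p) (𝓝[≠] 0) (𝓝 (s.g p 0)) :=
      ((s.continuousOn_g p).continuousAt ((L.atlas.chart p).open_target.mem_nhds hu)).tendsto.mono_left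
        nhdsWithin_le_nhds
    refine tendsto_nhds_unique h1 (tendsto_const_nhds.congr' ?_)
    filter_upwards [self_mem_nhdsWithin,
      nhdsWithin_le_nhds ((L.atlas.chart p).open_target.mem_nhds hu)] with w hw0 hw
    exact (hns p w hw (OrbifoldAtlas.not_isSpecial_symm hw hw0)).symm
  · exact hns p u hu (OrbifoldAtlas.not_isSpecial_symm hu hu0)

theorem spinEquation_of_isZero {H : HermitianMetric L} (hr : 2 ≤ r) (hs : s.IsZero) :
    s.SpinEquation φ H := by
  intro p z hz
  have hrep : ∀ w ∈ L.atlas.dom p, s.rep p w = 0 := fun w hw => by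
    rw [rep, hs p _ hw, mul_zero]
  rw [dbarCoeff, conjPowCoeff, hrep z hz.1, wirtingerBar_congr (g := fun _ => 0),
    wirtingerBar_const]
  -- For `r = 1` this would fail, since `0 ^ 0 = 1`.
  · simp [show r - 1 ≠ 0 by omega]
  · filter_upwards [(OrbifoldAtlas.isOpen_dom p).mem_nhds hz.1] with w hw using hrep w hw

end DesingSection

end Orbicurve

end

theorem lemma5p2p13 {N C : Type*} [TopologicalSpace N] [ChartedSpace ℂ N]
    [IsManifold 𝓘(ℂ) ω N] [CompactSpace N] [T2Space N]
    [TopologicalSpace C] [ConnectedSpace C]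
    (S : NodalOrbicurve N C) (r : ℕ) (hr : 2 ≤ r)
    (L : OrbifoldLineBundle S) (φ : LogCanonicalRoot L r) (H : HermitianMetric L)
    (hNS : ∀ p, S.IsMarked (S.π p) → L.IsNeveuSchwarz p)
    (s : DesingSection L) :
    s.SpinEquation φ H ↔ s.IsZero :=
  ⟨s.isZero_of_spinEquation φ hr hNS, s.spinEquation_of_isZero φ hr⟩
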